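/- Let $\mathcal{L}(\mathbb{Z})$ be the group von Neumann algebra of $\mathbb{Z}$ with its canonical trace, identified with $L_\infty(\mathbb{T})$, where $\mathbb{T}=\mathbb{R}/\mathbb{Z}$ carries its normalized Haar measure, by identifying the translation unitary $\lambda(k)$ with the character $e^{2\pi i k\,\cdot}$ for $k\in\mathbb{Z}$; thus $L_p(\mathcal{L}(\mathbb{Z}))=L_p(\mathbb{T})$ (complex-valued functions). For $t\ge 0$ let $\mathcal{P}_{\mathbb{Z},t}$ be the Poisson semigroup $$\mathcal{P}_{\mathbb{Z},t}\Big(\sum_{k\in\mathbb{Z}}\widehat f(k)\lambda(k)\Big)=\sum_{k\in\mathbb{Z}}e^{-t|k|}\widehat f(k)\lambda(k).$$ If $1<p\le q<\infty$ and $t\ge 0$, then $\mathcal{P}_{\mathbb{Z},t}$ maps $L_p(\mathcal{L}(\mathbb{Z}))$ boundedly into $L_q(\mathcal{L}(\mathbb{Z}))$ with operator norm $$\big\|\mathcal{P}_{\mathbb{Z},t}: L_p(\mathcal{L}(\mathbb{Z}))\to L_q(\mathcal{L}(\mathbb{Z}))\big\|=1$$ if and only if $t\ge \frac12\log\frac{q-1}{p-1}$.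 -/

import Mathlib

open MeasureTheory AddCircle
open scoped ENNReal

/-- `T` is the time-`t` map of the Poisson semigroup of `ℤ`, as a bounded operator from
`L_p` to `L_q` of the circle `𝕋 = ℝ/ℤ` with normalized Haar measure (that is, from `L_p(𝓛(ℤ))` to
`L_q(𝓛(ℤ))`, where the unitary `λ(k)` is identified with the character `x ↦ exp (2π i k x)`, and the
canonical trace with integration):
if `f = ∑ k, f̂(k) λ(k)` then `T f = ∑ k, exp (-t |k|) f̂(k) λ(k)`. A series is determined by its
Fourier coefficients, so this condition characterizes `T` uniquely (`IsPoissonOperator.unique`). -/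
def IsPoissonOperator (t : ℝ) {p q : ℝ≥0∞} [Fact (1 ≤ p)] [Fact (1 ≤ q)]
    (T : Lp ℂ p (haarAddCircle (T := 1)) →L[ℂ] Lp ℂ q (haarAddCircle (T := 1))) : Prop :=
  ∀ (f : Lp ℂ p (haarAddCircle (T := 1))) (k : ℤ),
    fourierCoeff (T f) k = (Real.exp (-t * |(k : ℝ)|) : ℂ) * fourierCoeff f k

/-- A function in `L_1(𝕋)` is determined by its Fourier coefficients. -/
theorem ae_eq_zero_of_fourierCoeff_eq_zero {g : AddCircle (1 : ℝ) → ℂ}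
    (hg : Integrable g haarAddCircle) (h : ∀ k, fourierCoeff g k = 0) :
    g =ᵐ[haarAddCircle] 0 := by
  have hint : ∀ φ : C(AddCircle (1 : ℝ), ℂ), Integrable (fun x => φ x * g x) haarAddCircle :=
    fun φ => hg.bdd_mul φ.continuous.aestronglyMeasurable
      (Filter.Eventually.of_forall fun x => φ.norm_coe_le_norm x)
  let L : C(AddCircle (1 : ℝ), ℂ) →ₗ[ℂ] ℂ :=
    { toFun := fun φ => ∫ x, φ x * g x ∂haarAddCircle
      map_add' := fun φ ψ => by
        simp only [ContinuousMap.add_apply, add_mul]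
        exact integral_add (hint φ) (hint ψ)
      map_smul' := fun c φ => by
        simp only [ContinuousMap.smul_apply, smul_eq_mul, mul_assoc, RingHom.id_apply]
        exact integral_const_mul c _ }
  let L' := L.mkContinuous (∫ x, ‖g x‖ ∂haarAddCircle) (fun φ => by
    refine (norm_integral_le_of_norm_le (hg.norm.const_mul ‖φ‖)
      (Filter.Eventually.of_forall fun x => ?_)).trans ?_
    · rw [norm_mul]; gcongr; exact φ.norm_coe_le_norm x
    · rw [integral_const_mul, mul_comm])
  have hL : L' = 0 := by
    refine ContinuousLinearMap.ext_on (s := Set.range (@fourier 1)) ?_ ?_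
    · rw [Submodule.dense_iff_topologicalClosure_eq_top]
      exact span_fourier_closure_eq_top
    · rintro _ ⟨k, rfl⟩
      have := h (-k)
      simp only [fourierCoeff, neg_neg, smul_eq_mul] at this
      exact this
  refine ae_eq_zero_of_forall_setIntegral_isClosed_eq_zero hg fun s hs => ?_
  have hpos : ∀ n : ℕ, (0 : ℝ) < 1 / ((n : ℝ) + 1) := fun n => by positivity
  let u : ℕ → C(AddCircle (1 : ℝ), ℂ) := fun n =>
    ⟨fun x => ((thickenedIndicator (hpos n) s x : ℝ) : ℂ), by fun_prop⟩
  have hlim : Filter.Tendsto (fun n => ∫ x, u n x * g x ∂haarAddCircle) Filter.atTop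
      (nhds (∫ x, s.indicator g x ∂haarAddCircle)) := by
    refine tendsto_integral_of_dominated_convergence (fun x => ‖g x‖)
      (fun n => (hint (u n)).aestronglyMeasurable) hg.norm (fun n => ?_) ?_
    · refine Filter.Eventually.of_forall fun x => ?_
      have h1 : (thickenedIndicator (hpos n) s x : ℝ) ≤ 1 := by
        exact_mod_cast thickenedIndicator_le_one (hpos n) s x
      have : ‖u n x‖ ≤ 1 := by simpa [u] using h1
      rw [norm_mul]
      exact mul_le_of_le_one_left (norm_nonneg _) this
    · refine Filter.Eventually.of_forall fun x => ?_
      have h1 := tendsto_pi_nhds.1 (thickenedIndicator_tendsto_indicator_closure hpos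
        tendsto_one_div_add_atTop_nhds_zero_nat s) x
      rw [hs.closure_eq] at h1
      have h2 : Filter.Tendsto (fun n => u n x) Filter.atTop
          (nhds (((s.indicator (fun _ => (1 : NNReal)) x : NNReal) : ℝ) : ℂ)) :=
        (Complex.continuous_ofReal.tendsto _).comp ((NNReal.continuous_coe.tendsto _).comp h1)
      have h3 := h2.mul_const (g x)
      convert h3 using 2
      by_cases hx : x ∈ s <;> simp [hx]
  have h0 : ∀ n, ∫ x, u n x * g x ∂haarAddCircle = 0 := fun n =>
    congrArg (fun M : C(AddCircle (1 : ℝ), ℂ) →L[ℂ] ℂ => M (u n)) hL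
  simp only [h0] at hlim
  rw [← integral_indicator hs.measurableSet]
  exact tendsto_nhds_unique hlim tendsto_const_nhds

/-- There is at most one such operator. -/
theorem IsPoissonOperator.unique {t : ℝ} {p q : ℝ≥0∞} [Fact (1 ≤ p)] [Fact (1 ≤ q)]
    {S T : Lp ℂ p (haarAddCircle (T := 1)) →L[ℂ] Lp ℂ q (haarAddCircle (T := 1))}
    (hS : IsPoissonOperator t S) (hT : IsPoissonOperator t T) : S = T := by
  ext1 f
  have hi : ∀ g : Lp ℂ q (haarAddCircle (T := 1)), Integrable g haarAddCircle :=
    fun g => (Lp.memLp g).integrable Fact.out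
  have h : ⇑(S f) - ⇑(T f) =ᵐ[haarAddCircle] 0 := by
    refine ae_eq_zero_of_fourierCoeff_eq_zero ((hi _).sub (hi _)) fun k => ?_
    have e : fourierCoeff (S f) k = fourierCoeff (T f) k := (hS f k).trans (hT f k).symm
    simp only [fourierCoeff] at e ⊢
    simp only [Pi.sub_apply, smul_sub]
    rw [integral_sub ((hi _).fourier_smul _) ((hi _).fourier_smul _), e, sub_self]
  refine Lp.ext ?_
  filter_upwards [h] with x hx
  exact sub_eq_zero.1 hx

-- Put r = exp(-t), so the semigroup is convolution with the Poisson kernel of radius r, a positive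
-- kernel of mass 1. Constants are fixed, so every norm is at least 1, and the question is when it
-- is at most 1.
--
-- Sufficiency is Gross's argument. Along q(t) = 1 + (p-1)exp(2t) the norm of u_t in L_{q(t)} is
-- nonincreasing for positive u (`log_integral_trigFlow_rpow_le`), because its derivative is
-- controlled by an L_q entropy inequality. That inequality follows from the L_2 logarithmic Sobolev
-- inequality Ent(g²) ≤ 2 ∑ |k| |ĝ(k)|² (`logSobolev_circle`) applied to g = u^{q/2}, with the
-- energies compared by the Stroock–Varopoulos inequality (`stroock_varopoulos_trigPoly`).
-- Positivity of the kernel reduces complex functions to positive trigonometric polynomials.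
--
-- The heart is the sharp constant 2. The entropy integrand is bounded by a cubic, s² log s² ≤
-- (2/3)s³ + s² - 2s + 1/3 for s ≥ 0 (`sq_mul_log_sq_le`), so only a third moment is needed. Writing
-- g = b + 2 Re h with h of positive frequencies, the hard term is Re ∫ h² h̄. A frequency m splits
-- as a sum of two positive ones in m-1 ways, so this term is bounded by the energy minus the
-- variance, up to quartic terms (`integral_cube_le_of_energy`). What remains is a nonpositive
-- polynomial in the mean.
--
-- Necessity tests T on 1 + 2ε cos(2πx) and compares coefficients of ε²
-- (`IsPoissonOperator.mul_exp_le`).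

local notation "𝕋" => AddCircle (1 : ℝ)
local notation "𝕞" => haarAddCircle (T := 1)

/-! ### Characters and integration on the circle -/

theorem integral_fourier (k : ℤ) : ∫ x, fourier k x ∂𝕞 = if k = 0 then 1 else 0 := by
  split_ifs with h
  · subst h; simp
  · exact integral_eq_zero_of_add_right_eq_neg (fourier_add_half_inv_index h one_pos)

theorem norm_fourier_apply (k : ℤ) (x : 𝕋) : ‖fourier k x‖ = 1 := by
  rw [fourier_apply]; exact Circle.norm_coe _

theorem fourier_eq_zpow (k : ℤ) (x : 𝕋) : fourier k x = (fourier 1 x) ^ k := by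
  simp [fourier_apply, AddCircle.toCircle_zsmul]

theorem Continuous.integrable_circle {E : Type*} [NormedAddCommGroup E] {f : 𝕋 → E}
    (hf : Continuous f) : Integrable f 𝕞 :=
  integrableOn_univ.1 (hf.continuousOn.integrableOn_compact isCompact_univ)

/-! ### The Poisson kernel and its Fourier expansion -/

/-- The Poisson kernel of radius `r` on the circle. -/
noncomputable def circlePoissonKernel (r : ℝ) (x : 𝕋) : ℝ :=
  (1 - r ^ 2) / Complex.normSq (1 - r * fourier 1 x)

theorem one_sub_mul_fourier_ne_zero {r : ℝ} (h0 : 0 ≤ r) (h1 : r < 1) (k : ℤ) (x : 𝕋) :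
    1 - (r : ℂ) * fourier k x ≠ 0 := by
  intro h
  have : ‖(r : ℂ) * fourier k x‖ = 1 := by rw [← sub_eq_zero.1 h]; simp
  rw [norm_mul, norm_fourier_apply, mul_one, Complex.norm_real, Real.norm_of_nonneg h0] at this
  exact h1.ne this

theorem circlePoissonKernel_nonneg {r : ℝ} (h0 : 0 ≤ r) (h1 : r < 1) (x : 𝕋) :
    0 ≤ circlePoissonKernel r x :=
  div_nonneg (by nlinarith) (Complex.normSq_nonneg _)

theorem continuous_circlePoissonKernel {r : ℝ} (h0 : 0 ≤ r) (h1 : r < 1) :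
    Continuous (circlePoissonKernel r) := by
  unfold circlePoissonKernel
  refine continuous_const.div ?_ fun x => ?_
  · exact Complex.continuous_normSq.comp
      (continuous_const.sub (continuous_const.mul (fourier 1).continuous))
  · exact fun h => one_sub_mul_fourier_ne_zero h0 h1 1 x (Complex.normSq_eq_zero.1 h)

theorem circlePoissonKernel_neg (r : ℝ) (x : 𝕋) :
    circlePoissonKernel r (-x) = circlePoissonKernel r x := by
  have h : fourier 1 (-x) = (starRingEnd ℂ) (fourier 1 x) := by
    rw [← fourier_neg]; simp [fourier_apply]
  unfold circlePoissonKernel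
  rw [h]
  congr 1
  rw [← Complex.normSq_conj]
  simp

theorem circlePoissonKernel_sub_comm (r : ℝ) (x y : 𝕋) :
    circlePoissonKernel r (x - y) = circlePoissonKernel r (y - x) := by
  rw [← circlePoissonKernel_neg, neg_sub]

theorem summable_pow_natAbs {r : ℝ} (h0 : 0 ≤ r) (h1 : r < 1) :
    Summable fun k : ℤ => r ^ k.natAbs := by
  refine Summable.of_nat_of_neg ?_ ?_ <;> simpa using summable_geometric_of_lt_one h0 h1

/-- The frequencies k ≥ 0 and k < 0 give two geometric series, whose sums combine over the common
denominator |1 - r e_1|². -/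
theorem hasSum_circlePoissonKernel {r : ℝ} (h0 : 0 ≤ r) (h1 : r < 1) (x : 𝕋) :
    HasSum (fun k : ℤ => (r : ℂ) ^ k.natAbs * fourier k x) (circlePoissonKernel r x) := by
  have hn : ∀ k : ℤ, ‖(r : ℂ) * fourier k x‖ < 1 := fun k => by
    rwa [norm_mul, norm_fourier_apply, mul_one, Complex.norm_real, Real.norm_of_nonneg h0]
  have e1 : HasSum (fun n : ℕ => (r : ℂ) ^ ((n : ℤ)).natAbs * fourier (n : ℤ) x)
      (1 - (r : ℂ) * fourier 1 x)⁻¹ := by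
    refine (hasSum_geometric_of_norm_lt_one (hn 1)).congr_fun fun n => ?_
    rw [fourier_eq_zpow n, mul_pow]; simp
  have e2 : HasSum (fun n : ℕ => (r : ℂ) ^ (-((n : ℤ) + 1)).natAbs * fourier (-((n : ℤ) + 1)) x)
      ((r * fourier (-1) x) * (1 - (r : ℂ) * fourier (-1) x)⁻¹) := by
    refine ((hasSum_geometric_of_norm_lt_one (hn (-1))).mul_left
      (r * fourier (-1) x)).congr_fun fun n => ?_
    have : (-((n : ℤ) + 1)).natAbs = n + 1 := by omega
    rw [this, ← pow_succ', mul_pow]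
    congr 1
    rw [fourier_eq_zpow, fourier_eq_zpow (-1), zpow_neg_one, inv_pow, zpow_neg]
    norm_cast
  have hz := one_sub_mul_fourier_ne_zero h0 h1 1 x
  have hz' := one_sub_mul_fourier_ne_zero h0 h1 (-1) x
  have hu : fourier 1 x * fourier (-1) x = 1 := by
    rw [← fourier_add]; simp
  have hs : ((Complex.normSq (1 - r * fourier 1 x) : ℝ) : ℂ)
      = (1 - r * fourier 1 x) * (1 - r * fourier (-1) x) := by
    rw [Complex.normSq_eq_conj_mul_self, fourier_neg, mul_comm, map_sub, map_mul, map_one,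
      Complex.conj_ofReal]
  have hv : ((circlePoissonKernel r x : ℝ) : ℂ) = (1 - (r : ℂ) * fourier 1 x)⁻¹ +
      (r * fourier (-1) x) * (1 - (r : ℂ) * fourier (-1) x)⁻¹ := by
    unfold circlePoissonKernel
    rw [Complex.ofReal_div, hs]
    push_cast
    generalize fourier 1 x = z at *
    generalize fourier (-1) x = w at *
    field_simp
    linear_combination ((r : ℂ) ^ 2) * hu
  rw [hv]
  exact e1.of_nat_of_neg_add_one e2

/-- Sum and integral may be exchanged because the k-th term has L_1 norm r^|k| ‖f‖_1, which is
summable. -/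
theorem integral_circlePoissonKernel_mul {r : ℝ} (h0 : 0 ≤ r) (h1 : r < 1) {f : 𝕋 → ℂ}
    (hf : Integrable f 𝕞) (x : 𝕋) :
    HasSum (fun k : ℤ => (r : ℂ) ^ k.natAbs * fourierCoeff f k * fourier k x)
      (∫ y, (circlePoissonKernel r (x - y) : ℂ) * f y ∂𝕞) := by
  have key := hasSum_integral_of_summable_integral_norm (μ := 𝕞)
    (F := fun (k : ℤ) (y : 𝕋) => ((r : ℂ) ^ k.natAbs * fourier k x) * (fourier (-k) y • f y))
    (fun k => (hf.fourier_smul (-k)).const_mul _) ?_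
  · have hA : (fun k : ℤ => (r : ℂ) ^ k.natAbs * fourierCoeff f k * fourier k x) = fun k : ℤ =>
        ∫ y, ((r : ℂ) ^ k.natAbs * fourier k x) * (fourier (-k) y • f y) ∂𝕞 := by
      ext k
      rw [integral_const_mul, fourierCoeff]; ring
    have hB : ∫ y, (circlePoissonKernel r (x - y) : ℂ) * f y ∂𝕞 =
        ∫ y, ∑' k : ℤ, ((r : ℂ) ^ k.natAbs * fourier k x) * (fourier (-k) y • f y) ∂𝕞 := by
      refine integral_congr_ae (Filter.Eventually.of_forall fun y => ?_)
      have := (hasSum_circlePoissonKernel h0 h1 (x - y)).mul_right (f y)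
      beta_reduce
      rw [← this.tsum_eq]
      refine tsum_congr fun k => ?_
      have : fourier k (x - y) = fourier k x * fourier (-k) y := by
        rw [fourier_apply, fourier_apply, fourier_apply, smul_sub, sub_eq_add_neg, ← neg_smul,
          AddCircle.toCircle_add, Circle.coe_mul]
      rw [this, smul_eq_mul]; ring
    rw [hA, hB]
    exact key
  · have : ∀ k : ℤ, ∫ y, ‖((r : ℂ) ^ k.natAbs * fourier k x) * (fourier (-k) y • f y)‖ ∂𝕞
        = r ^ k.natAbs * ∫ y, ‖f y‖ ∂𝕞 := fun k => by
      simp_rw [norm_mul, norm_smul, norm_fourier_apply, norm_pow, Complex.norm_real,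
        Real.norm_of_nonneg h0]
      rw [integral_const_mul]; simp
    simp_rw [this]
    exact (summable_pow_natAbs h0 h1).mul_right _

theorem norm_fourierCoeff_le (f : 𝕋 → ℂ) (k : ℤ) : ‖fourierCoeff f k‖ ≤ ∫ y, ‖f y‖ ∂𝕞 := by
  refine (norm_integral_le_integral_norm _).trans_eq ?_
  simp_rw [norm_smul, norm_fourier_apply, one_mul]

/-! ### The Poisson integral -/

/-- The Poisson integral of radius `r` of a function on the circle. -/
noncomputable def poissonIntegral (r : ℝ) (f : 𝕋 → ℂ) : C(𝕋, ℂ) :=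
  ∑' k : ℤ, ((r : ℂ) ^ k.natAbs * fourierCoeff f k) • fourier k

theorem norm_poisson_term_le {r : ℝ} (h0 : 0 ≤ r) (f : 𝕋 → ℂ) (k : ℤ) :
    ‖((r : ℂ) ^ k.natAbs * fourierCoeff f k) • fourier (T := 1) k‖
      ≤ r ^ k.natAbs * ∫ y, ‖f y‖ ∂𝕞 := by
  rw [norm_smul, fourier_norm, mul_one, norm_mul, norm_pow, Complex.norm_real,
    Real.norm_of_nonneg h0]
  gcongr
  exact norm_fourierCoeff_le f k

theorem summable_poissonIntegral {r : ℝ} (h0 : 0 ≤ r) (h1 : r < 1) (f : 𝕋 → ℂ) :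
    Summable fun k : ℤ => ((r : ℂ) ^ k.natAbs * fourierCoeff f k) • fourier (T := 1) k :=
  .of_norm_bounded ((summable_pow_natAbs h0 h1).mul_right _) fun k => norm_poisson_term_le h0 f k

theorem norm_poissonIntegral_le {r : ℝ} (h0 : 0 ≤ r) (h1 : r < 1) (f : 𝕋 → ℂ) :
    ‖poissonIntegral r f‖ ≤ (∑' k : ℤ, r ^ k.natAbs) * ∫ y, ‖f y‖ ∂𝕞 :=
  tsum_of_norm_bounded ((summable_pow_natAbs h0 h1).hasSum.mul_right _)
    fun k => norm_poisson_term_le h0 f k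

theorem poissonIntegral_apply {r : ℝ} (h0 : 0 ≤ r) (h1 : r < 1) {f : 𝕋 → ℂ}
    (hf : Integrable f 𝕞) (x : 𝕋) :
    poissonIntegral r f x = ∫ y, (circlePoissonKernel r (x - y) : ℂ) * f y ∂𝕞 := by
  refine HasSum.unique ?_ (integral_circlePoissonKernel_mul h0 h1 hf x)
  exact (ContinuousMap.evalCLM ℂ x).hasSum (summable_poissonIntegral h0 h1 f).hasSum

/-- The Fourier coefficient functional on continuous functions. -/
noncomputable def fourierCoeffCLM (k : ℤ) : C(𝕋, ℂ) →L[ℂ] ℂ :=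
  LinearMap.mkContinuous
    { toFun := fun f => fourierCoeff f k
      map_add' := fun f g => congrFun
        (fourierCoeff.add f.continuous.integrable_circle g.continuous.integrable_circle) k
      map_smul' := fun c f => fourierCoeff.const_smul f c k } 1 fun f => by
    refine (norm_fourierCoeff_le f k).trans ?_
    rw [one_mul]
    refine (integral_mono f.continuous.norm.integrable_circle (integrable_const ‖f‖)
      fun x => f.norm_coe_le_norm x).trans_eq ?_
    simp

theorem fourierCoeffCLM_apply (k : ℤ) (f : C(𝕋, ℂ)) : fourierCoeffCLM k f = fourierCoeff f k := rfl

theorem fourierCoeff_fourier_apply (j k : ℤ) :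
    fourierCoeff (fourier (T := 1) j) k = if j = k then 1 else 0 := by
  unfold fourierCoeff
  simp_rw [smul_eq_mul, ← fourier_add]
  rw [integral_fourier]
  exact if_congr (by omega) rfl rfl

theorem fourierCoeff_poissonIntegral {r : ℝ} (h0 : 0 ≤ r) (h1 : r < 1) (f : 𝕋 → ℂ) (k : ℤ) :
    fourierCoeff (poissonIntegral r f) k = (r : ℂ) ^ k.natAbs * fourierCoeff f k := by
  rw [← fourierCoeffCLM_apply, poissonIntegral,
    (fourierCoeffCLM k).map_tsum (summable_poissonIntegral h0 h1 f)]
  simp_rw [map_smul, fourierCoeffCLM_apply, fourierCoeff_fourier_apply]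
  rw [tsum_eq_single k fun j hj => by simp [hj]]
  simp

theorem integral_circlePoissonKernel_sub {r : ℝ} (h0 : 0 ≤ r) (h1 : r < 1) (x : 𝕋) :
    ∫ y, circlePoissonKernel r (x - y) ∂𝕞 = 1 := by
  have h := integral_circlePoissonKernel_mul h0 h1 (f := fourier (T := 1) 0)
    (fourier 0).continuous.integrable_circle x
  simp_rw [fourierCoeff_fourier_apply] at h
  have h2 := h.unique (hasSum_single 0 fun j hj => by simp [hj.symm])
  simp only [fourier_zero, mul_one, integral_complex_ofReal] at h2
  simpa using congrArg Complex.re h2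

theorem poissonIntegral_fourier (r : ℝ) (j : ℤ) :
    poissonIntegral r (fourier (T := 1) j) = ((r : ℂ) ^ j.natAbs) • fourier j := by
  unfold poissonIntegral
  simp_rw [fourierCoeff_fourier_apply]
  rw [tsum_eq_single j fun k hk => by ext; simp [hk.symm]]
  simp

theorem poissonIntegral_add {r : ℝ} (h0 : 0 ≤ r) (h1 : r < 1) {f g : 𝕋 → ℂ}
    (hf : Integrable f 𝕞) (hg : Integrable g 𝕞) :
    poissonIntegral r (f + g) = poissonIntegral r f + poissonIntegral r g := by
  unfold poissonIntegral
  rw [← (summable_poissonIntegral h0 h1 f).tsum_add (summable_poissonIntegral h0 h1 g),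
    fourierCoeff.add hf hg]
  refine tsum_congr fun k => ?_
  ext x
  simp [mul_add, add_mul]

theorem poissonIntegral_smul (r : ℝ) (c : ℂ) (f : 𝕋 → ℂ) :
    poissonIntegral r (c • f) = c • poissonIntegral r f := by
  unfold poissonIntegral
  rw [← tsum_const_smul'']
  refine tsum_congr fun k => ?_
  rw [fourierCoeff.const_smul, smul_smul, smul_eq_mul]
  ring_nf

theorem norm_poissonIntegral_apply_le {r : ℝ} (h0 : 0 ≤ r) (h1 : r < 1) {f : 𝕋 → ℂ}
    (hf : Integrable f 𝕞) (x : 𝕋) :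
    ‖poissonIntegral r f x‖ ≤ ∫ y, circlePoissonKernel r (x - y) * ‖f y‖ ∂𝕞 := by
  rw [poissonIntegral_apply h0 h1 hf]
  refine (norm_integral_le_integral_norm _).trans_eq ?_
  simp_rw [norm_mul, Complex.norm_real, Real.norm_of_nonneg (circlePoissonKernel_nonneg h0 h1 _)]

/-- A nonnegative kernel of mass 1 averages. The bound is uniform in r, which is what the passage to
the limit r → 1 needs. -/
theorem norm_poissonIntegral_le_norm {r : ℝ} (h0 : 0 ≤ r) (h1 : r < 1) (f : C(𝕋, ℂ)) :
    ‖poissonIntegral r f‖ ≤ ‖f‖ := by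
  refine (ContinuousMap.norm_le _ (norm_nonneg f)).2 fun x => ?_
  refine (norm_poissonIntegral_apply_le h0 h1 f.continuous.integrable_circle x).trans ?_
  have hc : Continuous fun y => circlePoissonKernel r (x - y) :=
    (continuous_circlePoissonKernel h0 h1).comp (continuous_const.sub continuous_id)
  calc _ ≤ ∫ y, circlePoissonKernel r (x - y) * ‖f‖ ∂𝕞 := by
        refine integral_mono (hc.mul f.continuous.norm).integrable_circle
          (hc.mul continuous_const).integrable_circle fun y => ?_
        exact mul_le_mul_of_nonneg_left (f.norm_coe_le_norm y) (circlePoissonKernel_nonneg h0 h1 _)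
    _ = ‖f‖ := by rw [integral_mul_const, integral_circlePoissonKernel_sub h0 h1, one_mul]

theorem re_poissonIntegral_apply {r : ℝ} (h0 : 0 ≤ r) (h1 : r < 1) {f : 𝕋 → ℂ}
    (hf : Continuous f) (x : 𝕋) :
    (poissonIntegral r f x).re = ∫ y, circlePoissonKernel r (x - y) * (f y).re ∂𝕞 := by
  have hc : Continuous fun y => circlePoissonKernel r (x - y) :=
    (continuous_circlePoissonKernel h0 h1).comp (continuous_const.sub continuous_id)
  have hi : Integrable (fun y => (circlePoissonKernel r (x - y) : ℂ) * f y) 𝕞 :=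
    ((Complex.continuous_ofReal.comp hc).mul hf).integrable_circle
  rw [poissonIntegral_apply h0 h1 hf.integrable_circle]
  have := integral_re hi
  simp only [RCLike.re_eq_complex_re, Complex.re_ofReal_mul] at this
  exact this.symm

/-! ### Moments of trigonometric polynomials up to order three -/

/-- `∑_{n < N} a_n e_{n+1}`, an analytic trigonometric polynomial without constant term. -/
noncomputable def analyticPoly (N : ℕ) (a : ℕ → ℂ) : C(𝕋, ℂ) :=
  ∑ n ∈ Finset.range N, a n • fourier ((n : ℤ) + 1)

theorem analyticPoly_apply (N : ℕ) (a : ℕ → ℂ) (x : 𝕋) :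
    analyticPoly N a x = ∑ n ∈ Finset.range N, a n * fourier ((n : ℤ) + 1) x := by
  simp only [analyticPoly, ContinuousMap.sum_apply, ContinuousMap.smul_apply, smul_eq_mul]

theorem conj_analyticPoly_apply (N : ℕ) (a : ℕ → ℂ) (x : 𝕋) :
    (starRingEnd ℂ) (analyticPoly N a x) =
      ∑ n ∈ Finset.range N, (starRingEnd ℂ) (a n) * fourier (-((n : ℤ) + 1)) x := by
  simp only [analyticPoly_apply, map_sum, map_mul, fourier_neg]

theorem integral_sum_fourier (s : Finset ℕ) (a : ℕ → ℂ) (α : ℕ → ℤ) :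
    ∫ x, (∑ j ∈ s, a j * fourier (α j) x) ∂𝕞 = ∑ j ∈ s, if α j = 0 then a j else 0 := by
  rw [integral_finsetSum _ fun j _ => Continuous.integrable_circle (by fun_prop)]
  refine Finset.sum_congr rfl fun j _ => ?_
  rw [integral_const_mul, integral_fourier]
  split_ifs <;> simp

theorem integral_sum_mul_sum_fourier (s : Finset ℕ) (a b : ℕ → ℂ) (α β : ℕ → ℤ) :
    ∫ x, (∑ j ∈ s, a j * fourier (α j) x) * (∑ k ∈ s, b k * fourier (β k) x) ∂𝕞 =
      ∑ j ∈ s, ∑ k ∈ s, if α j + β k = 0 then a j * b k else 0 := by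
  have : ∀ x : 𝕋, (∑ j ∈ s, a j * fourier (α j) x) * (∑ k ∈ s, b k * fourier (β k) x) =
      ∑ j ∈ s, ∑ k ∈ s, a j * b k * fourier (α j + β k) x := fun x => by
    rw [Finset.sum_mul_sum]
    refine Finset.sum_congr rfl fun j _ => Finset.sum_congr rfl fun k _ => ?_
    rw [fourier_add]; ring
  simp_rw [this]
  rw [integral_finsetSum _ fun j _ => Continuous.integrable_circle (by fun_prop)]
  exact Finset.sum_congr rfl fun j _ =>
    integral_sum_fourier s (fun k => a j * b k) (fun k => α j + β k)

theorem integral_sum_mul_sum_mul_sum_fourier (s : Finset ℕ) (a b c : ℕ → ℂ) (α β γ : ℕ → ℤ) :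
    ∫ x, (∑ j ∈ s, a j * fourier (α j) x) * (∑ k ∈ s, b k * fourier (β k) x) *
        (∑ l ∈ s, c l * fourier (γ l) x) ∂𝕞 =
      ∑ j ∈ s, ∑ k ∈ s, ∑ l ∈ s, if α j + β k + γ l = 0 then a j * b k * c l else 0 := by
  have : ∀ x : 𝕋, (∑ j ∈ s, a j * fourier (α j) x) * (∑ k ∈ s, b k * fourier (β k) x) *
      (∑ l ∈ s, c l * fourier (γ l) x) =
      ∑ j ∈ s, (∑ k ∈ s, (a j * b k) * fourier (α j + β k) x) *
        (∑ l ∈ s, c l * fourier (γ l) x) := fun x => by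
    rw [← Finset.sum_mul, Finset.sum_mul_sum]
    congr 1
    refine Finset.sum_congr rfl fun j _ => Finset.sum_congr rfl fun k _ => ?_
    rw [fourier_add]; ring
  simp_rw [this]
  rw [integral_finsetSum _ fun j _ => Continuous.integrable_circle (by fun_prop)]
  exact Finset.sum_congr rfl fun j _ =>
    integral_sum_mul_sum_fourier s (fun k => a j * b k) c (fun k => α j + β k) γ

/-- Here and for the square and the cube, all frequencies that occur are positive, so no constant
term appears. -/
theorem integral_analyticPoly (N : ℕ) (a : ℕ → ℂ) : ∫ x, analyticPoly N a x ∂𝕞 = 0 := by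
  simp_rw [analyticPoly_apply]
  rw [integral_sum_fourier]
  exact Finset.sum_eq_zero fun j _ => if_neg (by omega)

theorem integral_analyticPoly_sq (N : ℕ) (a : ℕ → ℂ) :
    ∫ x, analyticPoly N a x * analyticPoly N a x ∂𝕞 = 0 := by
  simp_rw [analyticPoly_apply]
  rw [integral_sum_mul_sum_fourier]
  exact Finset.sum_eq_zero fun j _ => Finset.sum_eq_zero fun k _ => if_neg (by omega)

theorem integral_analyticPoly_cube (N : ℕ) (a : ℕ → ℂ) :
    ∫ x, analyticPoly N a x * analyticPoly N a x * analyticPoly N a x ∂𝕞 = 0 := by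
  simp_rw [analyticPoly_apply]
  rw [integral_sum_mul_sum_mul_sum_fourier]
  exact Finset.sum_eq_zero fun j _ => Finset.sum_eq_zero fun k _ =>
    Finset.sum_eq_zero fun l _ => if_neg (by omega)

theorem integral_analyticPoly_mul_conj (N : ℕ) (a : ℕ → ℂ) :
    ∫ x, analyticPoly N a x * (starRingEnd ℂ) (analyticPoly N a x) ∂𝕞 =
      ((∑ n ∈ Finset.range N, ‖a n‖ ^ 2 : ℝ) : ℂ) := by
  simp_rw [conj_analyticPoly_apply, analyticPoly_apply]
  rw [integral_sum_mul_sum_fourier]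
  push_cast
  refine Finset.sum_congr rfl fun j hj => ?_
  rw [Finset.sum_eq_single_of_mem j hj fun k _ hk => if_neg (by omega), if_pos (by omega),
    Complex.mul_conj']

/-- Only triples with (j+1) + (k+1) = l+1 contribute, and each is split by xy ≤ x² + y²/4 with x =
|a_l|, y = |a_j||a_k|. The index l is hit by exactly l pairs (j, k), one less than its frequency
l+1; this deficit supplies the variance term that makes the logarithmic Sobolev constant sharp. -/
theorem re_integral_analyticPoly_sq_mul_conj_le (N : ℕ) (a : ℕ → ℂ) :
    (∫ x, analyticPoly N a x * analyticPoly N a x *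
        (starRingEnd ℂ) (analyticPoly N a x) ∂𝕞).re ≤
      ∑ n ∈ Finset.range N, (n : ℝ) * ‖a n‖ ^ 2 + (∑ n ∈ Finset.range N, ‖a n‖ ^ 2) ^ 2 / 4 := by
  simp_rw [conj_analyticPoly_apply, analyticPoly_apply]
  rw [integral_sum_mul_sum_mul_sum_fourier]
  simp only [Complex.re_sum]
  have hterm : ∀ j k l : ℕ, (if (j : ℤ) + 1 + (k + 1) + -(l + 1) = 0 then
      a j * a k * (starRingEnd ℂ) (a l) else 0).re ≤
      (if l = j + k + 1 then ‖a l‖ ^ 2 else 0) +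
        (if l = j + k + 1 then ‖a j‖ ^ 2 * ‖a k‖ ^ 2 / 4 else 0) := fun j k l => by
    by_cases h : l = j + k + 1
    · rw [if_pos (by omega), if_pos h, if_pos h]
      refine (Complex.re_le_norm _).trans ?_
      rw [norm_mul, norm_mul, RCLike.norm_conj]
      nlinarith [sq_nonneg (‖a l‖ - ‖a j‖ * ‖a k‖ / 2)]
    · rw [if_neg (by omega), if_neg h, if_neg h]; simp
  have h2 : ∑ j ∈ Finset.range N, ∑ k ∈ Finset.range N, ∑ l ∈ Finset.range N,
      (if l = j + k + 1 then ‖a l‖ ^ 2 else 0) ≤ ∑ l ∈ Finset.range N, (l : ℝ) * ‖a l‖ ^ 2 := by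
    have e1 : ∑ j ∈ Finset.range N, ∑ k ∈ Finset.range N, ∑ l ∈ Finset.range N,
        (if l = j + k + 1 then ‖a l‖ ^ 2 else 0) =
        ∑ l ∈ Finset.range N, ∑ j ∈ Finset.range N, ∑ k ∈ Finset.range N,
        (if l = j + k + 1 then ‖a l‖ ^ 2 else 0) := by
      rw [Finset.sum_comm (s := Finset.range N) (t := Finset.range N)
        (f := fun l j => ∑ k ∈ Finset.range N, if l = j + k + 1 then ‖a l‖ ^ 2 else 0)]
      exact Finset.sum_congr rfl fun j _ => Finset.sum_comm
    rw [e1]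
    refine Finset.sum_le_sum fun l hl => ?_
    -- For fixed l and j the only possible k is l - j - 1, and it exists precisely when j < l.
    have : ∀ j ∈ Finset.range N, ∑ k ∈ Finset.range N, (if l = j + k + 1 then ‖a l‖ ^ 2 else 0) ≤
        if j < l then ‖a l‖ ^ 2 else 0 := fun j _ => by
      by_cases hjl : j < l
      · rw [if_pos hjl, Finset.sum_eq_single (l - j - 1) (fun k _ hk => if_neg (by omega))
          (fun h => absurd (Finset.mem_range.2 (by have := Finset.mem_range.1 hl; omega)) h)]
        split_ifs <;> simp
      · rw [if_neg hjl]
        exact (Finset.sum_eq_zero fun k _ => if_neg (by omega)).le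
    refine (Finset.sum_le_sum this).trans_eq ?_
    rw [← Finset.sum_filter, Finset.sum_const, nsmul_eq_mul]
    congr 2
    have : (Finset.range N).filter (· < l) = Finset.range l := by
      ext j; have := Finset.mem_range.1 hl; simp; omega
    rw [this, Finset.card_range]
  have h3 : ∑ j ∈ Finset.range N, ∑ k ∈ Finset.range N, ∑ l ∈ Finset.range N,
      (if l = j + k + 1 then ‖a j‖ ^ 2 * ‖a k‖ ^ 2 / 4 else 0) ≤
      (∑ n ∈ Finset.range N, ‖a n‖ ^ 2) ^ 2 / 4 := by
    rw [sq, Finset.sum_mul_sum, Finset.sum_div]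
    simp_rw [Finset.sum_div]
    refine Finset.sum_le_sum fun j _ => Finset.sum_le_sum fun k _ => ?_
    rw [Finset.sum_ite_eq']
    split_ifs
    · rfl
    · positivity
  refine le_trans (Finset.sum_le_sum fun j _ => Finset.sum_le_sum fun k _ =>
    Finset.sum_le_sum fun l _ => hterm j k l) ?_
  simp_rw [Finset.sum_add_distrib]
  exact add_le_add h2 h3

theorem integral_re_circle {f : 𝕋 → ℂ} (hf : Continuous f) :
    ∫ x, (f x).re ∂𝕞 = (∫ x, f x ∂𝕞).re := by
  simpa using integral_re (𝕜 := ℂ) hf.integrable_circle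

theorem integral_const_add_re_analyticPoly (N : ℕ) (a : ℕ → ℂ) (b : ℝ) :
    ∫ x, (b + 2 * (analyticPoly N a x).re) ∂𝕞 = b := by
  have hc := (analyticPoly N a).continuous
  rw [integral_add (integrable_const b) (Continuous.integrable_circle (by fun_prop)),
    integral_const_mul,
    integral_re_circle hc, integral_analyticPoly]
  simp

theorem integral_const_add_re_analyticPoly_sq (N : ℕ) (a : ℕ → ℂ) (b : ℝ) :
    ∫ x, (b + 2 * (analyticPoly N a x).re) ^ 2 ∂𝕞 =
      b ^ 2 + 2 * ∑ n ∈ Finset.range N, ‖a n‖ ^ 2 := by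
  have hc := (analyticPoly N a).continuous
  have hcc := Complex.continuous_conj.comp hc
  have : ∀ x, (b + 2 * (analyticPoly N a x).re) ^ 2 = ((b : ℂ) ^ 2 + 4 * b * analyticPoly N a x +
      2 * (analyticPoly N a x * analyticPoly N a x) +
      2 * (analyticPoly N a x * (starRingEnd ℂ) (analyticPoly N a x))).re := fun x => by
    generalize analyticPoly N a x = z
    simp [pow_two]
    ring
  simp_rw [this]
  rw [integral_re_circle (by fun_prop), integral_add, integral_add, integral_add,
    integral_const_mul, integral_const_mul, integral_const_mul, integral_analyticPoly,
    integral_analyticPoly_sq, integral_analyticPoly_mul_conj]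
  · simp [pow_two]
  all_goals exact Continuous.integrable_circle (by fun_prop)

/-- In the expansion of (b + 2 Re h)³ the integrals of h, h² and h³ vanish; only b³, 6b|h|² and 6
Re(h² h̄) survive. -/
theorem integral_const_add_re_analyticPoly_cube_le (N : ℕ) (a : ℕ → ℂ) (b : ℝ) :
    ∫ x, (b + 2 * (analyticPoly N a x).re) ^ 3 ∂𝕞 ≤
      b ^ 3 + 6 * b * ∑ n ∈ Finset.range N, ‖a n‖ ^ 2 +
      6 * (∑ n ∈ Finset.range N, (n : ℝ) * ‖a n‖ ^ 2 +
        (∑ n ∈ Finset.range N, ‖a n‖ ^ 2) ^ 2 / 4) := by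
  have hc := (analyticPoly N a).continuous
  have hcc := Complex.continuous_conj.comp hc
  have : ∀ x, (b + 2 * (analyticPoly N a x).re) ^ 3 =
      ((b : ℂ) ^ 3 + (6 * b ^ 2 : ℂ) * analyticPoly N a x +
      (6 * b : ℂ) * (analyticPoly N a x * analyticPoly N a x) +
      (6 * b : ℂ) * (analyticPoly N a x * (starRingEnd ℂ) (analyticPoly N a x)) +
      2 * (analyticPoly N a x * analyticPoly N a x * analyticPoly N a x) +
      6 * (analyticPoly N a x * analyticPoly N a x *
        (starRingEnd ℂ) (analyticPoly N a x))).re := fun x => by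
    generalize analyticPoly N a x = z
    simp [pow_succ]
    ring
  simp_rw [this]
  rw [integral_re_circle (by fun_prop), integral_add, integral_add, integral_add, integral_add,
    integral_add,
    integral_const_mul, integral_const_mul, integral_const_mul, integral_const_mul,
    integral_const_mul, integral_analyticPoly,
    integral_analyticPoly_sq, integral_analyticPoly_mul_conj, integral_analyticPoly_cube]
  · have := re_integral_analyticPoly_sq_mul_conj_le N a
    generalize ∫ x, analyticPoly N a x * analyticPoly N a x *
        (starRingEnd ℂ) (analyticPoly N a x) ∂𝕞 = I at *
    generalize ∑ n ∈ Finset.range N, ‖a n‖ ^ 2 = A at *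
    simp [pow_succ] at this ⊢
    linarith
  all_goals exact Continuous.integrable_circle (by fun_prop)

/-! ### A cubic majorant of the entropy integrand -/

/-- After division by 2s² the difference of the two sides has derivative (s-1)³/(3s³), so it
decreases to its zero at s = 1 and increases afterwards. The cubic is chosen for this high contact
at 1. -/
theorem sq_mul_log_sq_le {s : ℝ} (hs : 0 ≤ s) :
    s ^ 2 * Real.log (s ^ 2) ≤ 2 / 3 * s ^ 3 + s ^ 2 - 2 * s + 1 / 3 := by
  rcases hs.eq_or_lt with rfl | hs
  · norm_num
  suffices h : Real.log s ≤ 1 / 3 * s + 1 / 2 - s⁻¹ + 1 / 6 * (s ^ 2)⁻¹ by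
    rw [Real.log_pow]
    have h2 := mul_le_mul_of_nonneg_left h (by positivity : 0 ≤ 2 * s ^ 2)
    have e : 2 * s ^ 2 * (1 / 3 * s + 1 / 2 - s⁻¹ + 1 / 6 * (s ^ 2)⁻¹) =
        2 / 3 * s ^ 3 + s ^ 2 - 2 * s + 1 / 3 := by field_simp; ring
    rw [e] at h2
    push_cast
    linarith
  let ψ : ℝ → ℝ := fun s => 1 / 3 * s + 1 / 2 - s⁻¹ + 1 / 6 * (s ^ 2)⁻¹ - Real.log s
  have hd : ∀ x : ℝ, 0 < x → HasDerivAt ψ ((x - 1) ^ 3 / (3 * x ^ 3)) x := fun x hx => by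
    have h1 := ((((hasDerivAt_id x).const_mul (1 / 3)).add_const (1 / 2)).sub
      (hasDerivAt_inv hx.ne')).add (((hasDerivAt_pow 2 x).inv (by positivity)).const_mul (1 / 6))
    have h2 := h1.sub (Real.hasDerivAt_log hx.ne')
    refine h2.congr_deriv ?_
    field_simp
    ring
  have h1 : ψ 1 = 0 := by simp [ψ]; norm_num
  suffices h : ψ 1 ≤ ψ s by
    rw [h1] at h
    exact sub_nonneg.1 h
  have hcont : ∀ x : ℝ, 0 < x → ContinuousAt ψ x := fun x hx => (hd x hx).continuousAt
  rcases le_total 1 s with h | h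
  · refine monotoneOn_of_deriv_nonneg (convex_Icc 1 s)
      (fun x hx => (hcont x (by linarith [hx.1])).continuousWithinAt) ?_ ?_
      (Set.left_mem_Icc.2 h) (Set.right_mem_Icc.2 h) h
    all_goals
      intro x hx
      rw [interior_Icc] at hx
      have hx0 : 0 < x := by linarith [hx.1]
    · exact (hd x hx0).differentiableAt.differentiableWithinAt
    · rw [(hd x hx0).deriv]
      have : 0 ≤ x - 1 := by linarith [hx.1]
      positivity
  · refine antitoneOn_of_deriv_nonpos (convex_Icc s 1)
      (fun x hx => (hcont x (by linarith [hx.1])).continuousWithinAt) ?_ ?_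
      (Set.left_mem_Icc.2 h) (Set.right_mem_Icc.2 h) h
    all_goals
      intro x hx
      rw [interior_Icc] at hx
      have hx0 : 0 < x := by linarith [hx.1]
    · exact (hd x hx0).differentiableAt.differentiableWithinAt
    · rw [(hd x hx0).deriv]
      refine div_nonpos_of_nonpos_of_nonneg ?_ (by positivity)
      exact (Odd.pow_nonpos (by decide) (by linarith [hx.2]))

/-! ### Approximation and the cubic energy inequality -/

/-- Convergence is immediate on characters, hence on their span; uniform contractivity and density
of the span give the rest. -/
theorem tendsto_poissonIntegral (f : C(𝕋, ℂ)) :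
    Filter.Tendsto (fun r => poissonIntegral r f) (nhdsWithin 1 (Set.Ico 0 1)) (nhds f) := by
  have hmem : ∀ᶠ r in nhdsWithin (1 : ℝ) (Set.Ico 0 1), r ∈ Set.Ico (0 : ℝ) 1 :=
    self_mem_nhdsWithin
  have hspan : ∀ g ∈ Submodule.span ℂ (Set.range (@fourier 1)),
      Filter.Tendsto (fun r => poissonIntegral r g) (nhdsWithin 1 (Set.Ico 0 1)) (nhds g) := by
    intro g hg
    induction hg using Submodule.span_induction with
    | mem x hx =>
      obtain ⟨k, rfl⟩ := hx
      simp_rw [poissonIntegral_fourier]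
      have h1 : Filter.Tendsto (fun r : ℝ => ((r : ℂ) ^ k.natAbs)) (nhdsWithin 1 (Set.Ico 0 1))
          (nhds (((1 : ℝ) : ℂ) ^ k.natAbs)) :=
        ((Complex.continuous_ofReal.pow _).tendsto 1).mono_left nhdsWithin_le_nhds
      have h2 := h1.smul_const (fourier (T := 1) k)
      simpa using h2
    | zero =>
      have : ∀ r, poissonIntegral r ((0 : C(𝕋, ℂ)) : 𝕋 → ℂ) = 0 := fun r => by
        have := poissonIntegral_smul r 0 (0 : 𝕋 → ℂ)
        ext x
        simpa using DFunLike.congr_fun this x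
      simp_rw [this]
      exact tendsto_const_nhds
    | add x y _ _ hx hy =>
      refine (hx.add hy).congr' ?_
      filter_upwards [hmem] with r hr
      exact (poissonIntegral_add hr.1 hr.2 x.continuous.integrable_circle
        y.continuous.integrable_circle).symm
    | smul c x _ hx =>
      refine (hx.const_smul c).congr fun r => ?_
      exact (poissonIntegral_smul r c x).symm
  rw [Metric.tendsto_nhds]
  intro ε hε
  have hd : f ∈ closure (Submodule.span ℂ (Set.range (@fourier 1)) : Set C(𝕋, ℂ)) := by
    have := span_fourier_closure_eq_top (T := 1)
    rw [← Submodule.topologicalClosure_coe, this]; trivial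
  obtain ⟨g, hg, hfg⟩ := Metric.mem_closure_iff.1 hd (ε / 3) (by positivity)
  filter_upwards [hmem, Metric.tendsto_nhds.1 (hspan g hg) (ε / 3) (by positivity)] with r hr hrg
  have h1 : poissonIntegral r f = poissonIntegral r ((f - g : C(𝕋, ℂ))) + poissonIntegral r g := by
    rw [← poissonIntegral_add hr.1 hr.2 (f - g).continuous.integrable_circle
      g.continuous.integrable_circle]
    congr 1; ext x; simp
  have h2 := norm_poissonIntegral_le_norm hr.1 hr.2 (f - g)
  rw [dist_eq_norm] at *
  calc ‖poissonIntegral r f - f‖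
      = ‖poissonIntegral r ((f - g : C(𝕋, ℂ))) + (poissonIntegral r g - g) - (f - g)‖ := by
        rw [h1]; congr 1; abel
    _ ≤ ‖poissonIntegral r ((f - g : C(𝕋, ℂ)))‖ + ‖poissonIntegral r g - g‖ + ‖f - g‖ :=
        (norm_sub_le _ _).trans (by gcongr; exact norm_add_le _ _)
    _ < ε := by linarith

theorem fourierCoeff_ofReal_neg (g : 𝕋 → ℝ) (k : ℤ) :
    fourierCoeff (fun x => (g x : ℂ)) (-k) =
      (starRingEnd ℂ) (fourierCoeff (fun x => (g x : ℂ)) k) := by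
  unfold fourierCoeff
  rw [← integral_conj]
  refine integral_congr_ae (Filter.Eventually.of_forall fun x => ?_)
  simp only [smul_eq_mul, map_mul, Complex.conj_ofReal, ← fourier_neg, neg_neg]

/-- The real trigonometric polynomial `b + 2 Re ∑_{n < N} a_n e_{n+1}`. -/
noncomputable def realPoly (N : ℕ) (a : ℕ → ℂ) (b : ℝ) : C(𝕋, ℝ) where
  toFun x := b + 2 * (analyticPoly N a x).re
  continuous_toFun := by fun_prop

/-- The Fourier series of a continuous function need not converge uniformly, but its Abel sums of
radius r < 1 do. Frequencies k and -k are paired, being conjugate for real g. -/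
theorem tendsto_realPoly {r : ℝ} (h0 : 0 ≤ r) (h1 : r < 1) (g : C(𝕋, ℝ)) :
    Filter.Tendsto (fun N => realPoly N
        (fun n => (r : ℂ) ^ (n + 1) * fourierCoeff (fun x => (g x : ℂ)) ((n : ℤ) + 1))
        (∫ x, g x ∂𝕞)) Filter.atTop
      (nhds ((⟨Complex.re, Complex.continuous_re⟩ : C(ℂ, ℝ)).comp
        (poissonIntegral r fun x => (g x : ℂ)))) := by
  have hs := (summable_poissonIntegral h0 h1 fun x => (g x : ℂ)).hasSum
  have h2 := (hs.nat_add_neg).tendsto_sum_nat.comp (Filter.tendsto_add_atTop_nat 1)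
  have h3 := h2.sub_const (((r : ℂ) ^ (0 : ℤ).natAbs * fourierCoeff (fun x => (g x : ℂ)) 0) •
    fourier (T := 1) 0)
  rw [add_sub_cancel_right] at h3
  have h4 := ((⟨Complex.re, Complex.continuous_re⟩ : C(ℂ, ℝ)).continuous_postcomp.tendsto _).comp h3
  refine h4.congr fun N => ?_
  ext x
  have hb : fourierCoeff (fun x => (g x : ℂ)) 0 = ((∫ x, g x ∂𝕞 : ℝ) : ℂ) := by
    simp [fourierCoeff, integral_complex_ofReal]
  have hterm : ∀ n : ℕ, ((((r : ℂ) ^ (((n + 1 : ℕ) : ℤ)).natAbs *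
      fourierCoeff (fun x => (g x : ℂ)) ((n + 1 : ℕ) : ℤ)) * fourier ((n + 1 : ℕ) : ℤ) x) +
      (((r : ℂ) ^ (-((n + 1 : ℕ) : ℤ)).natAbs *
      fourierCoeff (fun x => (g x : ℂ)) (-((n + 1 : ℕ) : ℤ))) *
        fourier (-((n + 1 : ℕ) : ℤ)) x)).re =
      2 * (((r : ℂ) ^ (n + 1) * fourierCoeff (fun x => (g x : ℂ)) ((n : ℤ) + 1)) *
        fourier ((n : ℤ) + 1) x).re := fun n => by
    rw [fourierCoeff_ofReal_neg, fourier_neg, Int.natAbs_neg, Int.natAbs_natCast]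
    have : ((r : ℂ) ^ (n + 1) * (starRingEnd ℂ) (fourierCoeff (fun x => (g x : ℂ)) ((n + 1 : ℕ) : ℤ))
        * (starRingEnd ℂ) (fourier ((n + 1 : ℕ) : ℤ) x)) = (starRingEnd ℂ)
        ((r : ℂ) ^ (n + 1) * fourierCoeff (fun x => (g x : ℂ)) ((n + 1 : ℕ) : ℤ) *
          fourier ((n + 1 : ℕ) : ℤ) x) := by
      simp only [map_mul, map_pow, Complex.conj_ofReal]
    rw [this, Complex.add_re, Complex.conj_re]
    push_cast
    ring
  simp only [realPoly, Function.comp_apply, ContinuousMap.comp_apply, ContinuousMap.coe_mk,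
    ContinuousMap.sub_apply, ContinuousMap.sum_apply, ContinuousMap.add_apply,
    ContinuousMap.smul_apply, analyticPoly_apply, smul_eq_mul]
  rw [Finset.sum_range_succ', Complex.sub_re, Complex.add_re, Complex.re_sum, Complex.re_sum,
    Finset.mul_sum]
  simp_rw [hterm]
  simp only [Nat.cast_zero, neg_zero, Int.natAbs_zero, pow_zero, one_mul, fourier_zero, mul_one, hb,
    Complex.add_re, Complex.ofReal_re]
  ring

theorem continuous_integral_circle : Continuous fun f : C(𝕋, ℝ) => ∫ x, f x ∂𝕞 := by
  refine LipschitzWith.continuous (K := 1) (LipschitzWith.of_dist_le_mul fun f g => ?_)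
  rw [NNReal.coe_one, one_mul, dist_eq_norm, dist_eq_norm,
    ← integral_sub f.continuous.integrable_circle g.continuous.integrable_circle]
  refine (norm_integral_le_of_norm_le_const (C := ‖f - g‖)
    (Filter.Eventually.of_forall fun x => (f - g).norm_coe_le_norm x)).trans_eq ?_
  simp

theorem continuous_integral_pow_circle (m : ℕ) :
    Continuous fun f : C(𝕋, ℝ) => ∫ x, f x ^ m ∂𝕞 :=
  continuous_integral_circle.comp (continuous_pow m)

/-- Cubic energy inequality for real functions on the circle. -/
theorem integral_cube_le_of_energy (g : C(𝕋, ℝ)) {B : ℝ}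
    (hB : ∀ N : ℕ, 2 * ∑ n ∈ Finset.range N,
      ((n : ℝ) + 1) * ‖fourierCoeff (fun x => (g x : ℂ)) ((n : ℤ) + 1)‖ ^ 2 ≤ B) :
    2 / 3 * ∫ x, g x ^ 3 ∂𝕞 ≤ 2 / 3 * (∫ x, g x ∂𝕞) ^ 3 +
      2 * (∫ x, g x ∂𝕞) * (∫ x, g x ^ 2 ∂𝕞 - (∫ x, g x ∂𝕞) ^ 2) -
      2 * (∫ x, g x ^ 2 ∂𝕞 - (∫ x, g x ∂𝕞) ^ 2) +
      (∫ x, g x ^ 2 ∂𝕞 - (∫ x, g x ∂𝕞) ^ 2) ^ 2 / 4 + 2 * B := by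
  let S : Set C(𝕋, ℝ) := {f | 2 / 3 * ∫ x, f x ^ 3 ∂𝕞 ≤ 2 / 3 * (∫ x, f x ∂𝕞) ^ 3 +
      2 * (∫ x, f x ∂𝕞) * (∫ x, f x ^ 2 ∂𝕞 - (∫ x, f x ∂𝕞) ^ 2) -
      2 * (∫ x, f x ^ 2 ∂𝕞 - (∫ x, f x ∂𝕞) ^ 2) +
      (∫ x, f x ^ 2 ∂𝕞 - (∫ x, f x ∂𝕞) ^ 2) ^ 2 / 4 + 2 * B}
  have hS : IsClosed S := by
    have c1 := continuous_integral_circle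
    have c2 := continuous_integral_pow_circle 2
    have c3 := continuous_integral_pow_circle 3
    exact isClosed_le (by fun_prop) (by fun_prop)
  -- The inequality is closed under uniform limits, so it suffices to have it for damped partial
  -- sums: let N → ∞ first, then r → 1.
  have hpoly : ∀ r : ℝ, 0 ≤ r → r < 1 → ∀ N : ℕ, realPoly N
      (fun n => (r : ℂ) ^ (n + 1) * fourierCoeff (fun x => (g x : ℂ)) ((n : ℤ) + 1))
      (∫ x, g x ∂𝕞) ∈ S := by
    intro r h0 h1 N
    set b := ∫ x, g x ∂𝕞
    set a : ℕ → ℂ := fun n => (r : ℂ) ^ (n + 1) * fourierCoeff (fun x => (g x : ℂ)) ((n : ℤ) + 1)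
    have e1 := integral_const_add_re_analyticPoly N a b
    have e2 := integral_const_add_re_analyticPoly_sq N a b
    have e3 := integral_const_add_re_analyticPoly_cube_le N a b
    -- The weight n of the cubic estimate is the frequency n+1 minus 1, and damping by r^(n+1) only
    -- lowers the energy.
    have hE : ∑ n ∈ Finset.range N, ((n : ℝ) * ‖a n‖ ^ 2) + ∑ n ∈ Finset.range N, ‖a n‖ ^ 2 ≤
        B / 2 := by
      rw [← Finset.sum_add_distrib]
      have := hB N
      refine le_trans (Finset.sum_le_sum fun n _ => ?_)
        (show ∑ n ∈ Finset.range N, ((n : ℝ) + 1) *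
          ‖fourierCoeff (fun x => (g x : ℂ)) ((n : ℤ) + 1)‖ ^ 2 ≤ B / 2 by linarith)
      have hle : ‖a n‖ ≤ ‖fourierCoeff (fun x => (g x : ℂ)) ((n : ℤ) + 1)‖ := by
        simp only [a, norm_mul, norm_pow, Complex.norm_real, Real.norm_of_nonneg h0]
        exact mul_le_of_le_one_left (norm_nonneg _) (pow_le_one₀ h0 h1.le)
      rw [← add_one_mul]
      gcongr
    change 2 / 3 * ∫ x, (b + 2 * (analyticPoly N a x).re) ^ 3 ∂𝕞 ≤
      2 / 3 * (∫ x, (b + 2 * (analyticPoly N a x).re) ∂𝕞) ^ 3 +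
      2 * (∫ x, (b + 2 * (analyticPoly N a x).re) ∂𝕞) *
      (∫ x, (b + 2 * (analyticPoly N a x).re) ^ 2 ∂𝕞 -
        (∫ x, (b + 2 * (analyticPoly N a x).re) ∂𝕞) ^ 2) -
      2 * (∫ x, (b + 2 * (analyticPoly N a x).re) ^ 2 ∂𝕞 -
        (∫ x, (b + 2 * (analyticPoly N a x).re) ∂𝕞) ^ 2) +
      (∫ x, (b + 2 * (analyticPoly N a x).re) ^ 2 ∂𝕞 -
        (∫ x, (b + 2 * (analyticPoly N a x).re) ∂𝕞) ^ 2) ^ 2 / 4 + 2 * B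
    rw [e1, e2]
    generalize ∑ n ∈ Finset.range N, ‖a n‖ ^ 2 = A at *
    linarith
  have hr : ∀ r ∈ Set.Ico (0 : ℝ) 1, (⟨Complex.re, Complex.continuous_re⟩ : C(ℂ, ℝ)).comp
        (poissonIntegral r fun x => (g x : ℂ)) ∈ S := fun r hr =>
    hS.mem_of_tendsto (tendsto_realPoly hr.1 hr.2 g)
      (Filter.Eventually.of_forall (hpoly r hr.1 hr.2))
  have hne : (nhdsWithin (1 : ℝ) (Set.Ico 0 1)).NeBot := by
    rw [← mem_closure_iff_nhdsWithin_neBot, closure_Ico (by norm_num)]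
    exact Set.right_mem_Icc.2 zero_le_one
  let gc : C(𝕋, ℂ) := ⟨fun x => (g x : ℂ), by fun_prop⟩
  have ht := ((⟨Complex.re, Complex.continuous_re⟩ : C(ℂ, ℝ)).continuous_postcomp.tendsto _).comp
    (tendsto_poissonIntegral gc)
  have := hS.mem_of_tendsto ht (Filter.mem_of_superset self_mem_nhdsWithin hr)
  have e : (⟨Complex.re, Complex.continuous_re⟩ : C(ℂ, ℝ)).comp gc = g := by ext x; simp [gc]
  rw [e] at this
  exact this

/-! ### The logarithmic Sobolev inequality -/

/-- Integrate the cubic majorant and insert the cubic energy inequality with variance 1 - b², where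
b is the mean. The terms other than 2B add up to (1-b)²(3b² - 10b - 5)/12, which is nonpositive for
0 ≤ b ≤ 1. -/
theorem logSobolev_of_integral_sq_eq_one (g : C(𝕋, ℝ)) (hg : ∀ x, 0 ≤ g x)
    (h1 : ∫ x, g x ^ 2 ∂𝕞 = 1) {B : ℝ}
    (hB : ∀ N : ℕ, 2 * ∑ n ∈ Finset.range N,
      ((n : ℝ) + 1) * ‖fourierCoeff (fun x => (g x : ℂ)) ((n : ℤ) + 1)‖ ^ 2 ≤ B) :
    ∫ x, g x ^ 2 * Real.log (g x ^ 2) ∂𝕞 ≤ 2 * B := by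
  have hcub := integral_cube_le_of_energy g hB
  have hcont := g.continuous
  have hb0 : 0 ≤ ∫ x, g x ∂𝕞 := integral_nonneg hg
  have hi1 : Integrable (fun x => g x) 𝕞 := hcont.integrable_circle
  have hi2 : Integrable (fun x => g x ^ 2) 𝕞 := (hcont.pow 2).integrable_circle
  have hi3 : Integrable (fun x => g x ^ 3) 𝕞 := (hcont.pow 3).integrable_circle
  have hb1 : ∫ x, g x ∂𝕞 ≤ 1 := by
    have : ∫ x, g x ∂𝕞 ≤ ∫ x, (1 / 2 + 1 / 2 * g x ^ 2) ∂𝕞 :=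
      integral_mono hi1 ((integrable_const _).add (hi2.const_mul _)) fun x => by
        simp only; nlinarith [sq_nonneg (g x - 1)]
    rw [integral_add (integrable_const _) (hi2.const_mul _), integral_const_mul, h1] at this
    simp at this
    linarith
  have hlog : ∫ x, g x ^ 2 * Real.log (g x ^ 2) ∂𝕞 ≤
      ∫ x, (2 / 3 * g x ^ 3 + g x ^ 2 - 2 * g x + 1 / 3) ∂𝕞 := by
    refine integral_mono (Continuous.integrable_circle ?_)
      ((((hi3.const_mul _).add hi2).sub (hi1.const_mul _)).add (integrable_const _))
      fun x => sq_mul_log_sq_le (hg x)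
    exact Real.continuous_mul_log.comp (hcont.pow 2)
  have hexp : ∫ x, (2 / 3 * g x ^ 3 + g x ^ 2 - 2 * g x + 1 / 3) ∂𝕞 =
      2 / 3 * ∫ x, g x ^ 3 ∂𝕞 + 1 - 2 * ∫ x, g x ∂𝕞 + 1 / 3 := by
    rw [integral_add, integral_sub, integral_add, integral_const_mul, integral_const_mul, h1]
    · simp
    all_goals exact Continuous.integrable_circle (by fun_prop)
  rw [hexp] at hlog
  rw [h1] at hcub
  generalize ∫ x, g x ∂𝕞 = b at *
  have hpoly : (1 - b) ^ 2 * (3 * b ^ 2 - 10 * b - 5) ≤ 0 :=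
    mul_nonpos_of_nonneg_of_nonpos (sq_nonneg _) (by nlinarith)
  nlinarith

/-- The logarithmic Sobolev inequality for the Poisson semigroup on the circle. -/
theorem logSobolev_circle (g : C(𝕋, ℝ)) (hg : ∀ x, 0 ≤ g x) (hpos : 0 < ∫ x, g x ^ 2 ∂𝕞) {B : ℝ}
    (hB : ∀ N : ℕ, 2 * ∑ n ∈ Finset.range N,
      ((n : ℝ) + 1) * ‖fourierCoeff (fun x => (g x : ℂ)) ((n : ℤ) + 1)‖ ^ 2 ≤ B) :
    ∫ x, g x ^ 2 * Real.log (g x ^ 2) ∂𝕞 -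
      (∫ x, g x ^ 2 ∂𝕞) * Real.log (∫ x, g x ^ 2 ∂𝕞) ≤ 2 * B := by
  set I := ∫ x, g x ^ 2 ∂𝕞 with hI
  -- Both sides are homogeneous of degree 2, so g may be normalized in L_2.
  set c := (Real.sqrt I)⁻¹ with hc
  have hc2 : c ^ 2 = I⁻¹ := by rw [hc, inv_pow, Real.sq_sqrt hpos.le]
  have hc0 : 0 ≤ c := by positivity
  have hn : ∫ x, (c • g) x ^ 2 ∂𝕞 = 1 := by
    simp only [ContinuousMap.smul_apply, smul_eq_mul, mul_pow]
    rw [integral_const_mul, hc2, ← hI, inv_mul_cancel₀ hpos.ne']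
  have key := logSobolev_of_integral_sq_eq_one (c • g)
    (fun x => mul_nonneg hc0 (hg x)) hn (B := c ^ 2 * B) fun N => by
      have he : ∀ k, fourierCoeff (fun x => (((c • g) x : ℝ) : ℂ)) k =
          (c : ℂ) * fourierCoeff (fun x => (g x : ℂ)) k := fun k => by
        rw [← fourierCoeff.const_mul]; simp
      simp_rw [he, norm_mul, mul_pow, Complex.norm_real, Real.norm_of_nonneg hc0]
      have := mul_le_mul_of_nonneg_left (hB N) (sq_nonneg c)
      refine le_trans (le_of_eq ?_) this
      rw [Finset.mul_sum, Finset.mul_sum, Finset.mul_sum]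
      exact Finset.sum_congr rfl fun n _ => by ring
  have hcont := g.continuous
  have e : ∀ x, (c • g) x ^ 2 * Real.log ((c • g) x ^ 2) =
      I⁻¹ * (g x ^ 2 * Real.log (g x ^ 2)) - I⁻¹ * Real.log I * g x ^ 2 := fun x => by
    simp only [ContinuousMap.smul_apply, smul_eq_mul, mul_pow, hc2]
    by_cases hx : g x = 0
    · simp [hx]
    · rw [Real.log_mul (inv_ne_zero hpos.ne') (pow_ne_zero 2 hx), Real.log_inv]; ring
  simp_rw [e] at key
  rw [integral_sub, integral_const_mul, integral_const_mul, ← hI, hc2] at key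
  · have := mul_le_mul_of_nonneg_left key hpos.le
    have hI0 := hpos.ne'
    field_simp at this
    linarith
  · exact (Real.continuous_mul_log.comp (hcont.pow 2)).integrable_circle.const_mul _
  · exact (hcont.pow 2).integrable_circle.const_mul _

/-! ### The Dirichlet form and the Stroock–Varopoulos inequality -/

/-- Expanding the product leaves two equal diagonal terms, as the kernel has mass 1, and two equal
mixed terms, as it is symmetric. The form of 1 - P_r thus becomes an average of increments, where
pointwise inequalities apply. -/
theorem integral_circlePoissonKernel_mul_sub_mul_sub {r : ℝ} (h0 : 0 ≤ r) (h1 : r < 1)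
    {f h : 𝕋 → ℝ} (hf : Continuous f) (hh : Continuous h) :
    ∫ x, ∫ y, circlePoissonKernel r (x - y) * ((f x - f y) * (h x - h y)) ∂𝕞 ∂𝕞 =
      2 * (∫ x, f x * h x ∂𝕞 - ∫ x, (∫ y, circlePoissonKernel r (x - y) * f y ∂𝕞) * h x ∂𝕞) := by
  have hK := continuous_circlePoissonKernel h0 h1
  have swap : ∀ F : 𝕋 → 𝕋 → ℝ, Continuous F.uncurry →
      ∫ x, ∫ y, F x y ∂𝕞 ∂𝕞 = ∫ y, ∫ x, F x y ∂𝕞 ∂𝕞 := fun F hF =>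
    integral_integral_swap_of_hasCompactSupport hF (HasCompactSupport.of_compactSpace _)
  have cint : ∀ F : 𝕋 → 𝕋 → ℝ, Continuous F.uncurry → Continuous fun x => ∫ y, F x y ∂𝕞 := by
    intro F hF
    have := continuous_parametric_integral_of_continuous (μ := 𝕞) hF isCompact_univ
    simpa using this
  have hA : ∀ x, ∫ y, circlePoissonKernel r (x - y) * ((f x - f y) * (h x - h y)) ∂𝕞 =
      f x * h x - ∫ y, circlePoissonKernel r (x - y) * f x * h y ∂𝕞 -
      (∫ y, circlePoissonKernel r (x - y) * f y ∂𝕞) * h x +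
      ∫ y, circlePoissonKernel r (x - y) * (f y * h y) ∂𝕞 := fun x => by
    have e : ∀ y, circlePoissonKernel r (x - y) * ((f x - f y) * (h x - h y)) =
        circlePoissonKernel r (x - y) * (f x * h x) - circlePoissonKernel r (x - y) * f x * h y -
        circlePoissonKernel r (x - y) * f y * h x + circlePoissonKernel r (x - y) * (f y * h y) :=
      fun y => by ring
    simp_rw [e]
    rw [integral_add, integral_sub, integral_sub, integral_mul_const, integral_mul_const,
      integral_circlePoissonKernel_sub h0 h1, one_mul]
    all_goals exact Continuous.integrable_circle (by fun_prop)
  simp_rw [hA]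
  have c1 : Continuous fun x => ∫ y, circlePoissonKernel r (x - y) * f x * h y ∂𝕞 :=
    cint (fun x y => circlePoissonKernel r (x - y) * f x * h y) (by fun_prop)
  have c2 : Continuous fun x => ∫ y, circlePoissonKernel r (x - y) * f y ∂𝕞 :=
    cint (fun x y => circlePoissonKernel r (x - y) * f y) (by fun_prop)
  have c3 : Continuous fun x => ∫ y, circlePoissonKernel r (x - y) * (f y * h y) ∂𝕞 :=
    cint (fun x y => circlePoissonKernel r (x - y) * (f y * h y)) (by fun_prop)
  rw [integral_add, integral_sub, integral_sub,
    swap (fun x y => circlePoissonKernel r (x - y) * f x * h y) (by fun_prop),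
    swap (fun x y => circlePoissonKernel r (x - y) * (f y * h y)) (by fun_prop)]
  · have e1 : ∀ y, ∫ x, circlePoissonKernel r (x - y) * f x * h y ∂𝕞 =
        (∫ x, circlePoissonKernel r (y - x) * f x ∂𝕞) * h y := fun y => by
      rw [integral_mul_const]
      simp_rw [circlePoissonKernel_sub_comm r y]
    have e2 : ∀ y, ∫ x, circlePoissonKernel r (x - y) * (f y * h y) ∂𝕞 = f y * h y := fun y => by
      rw [integral_mul_const]
      simp_rw [circlePoissonKernel_sub_comm r _ y]
      rw [integral_circlePoissonKernel_sub h0 h1, one_mul]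
    simp_rw [e1, e2]
    ring
  all_goals exact Continuous.integrable_circle (by fun_prop)

theorem hasSum_one_sub_pow_mul_sq_fourierCoeff {r : ℝ} (h0 : 0 ≤ r) (h1 : r < 1) {g : 𝕋 → ℝ}
    (hg : Continuous g) :
    HasSum (fun k : ℤ => (1 - r ^ k.natAbs) * ‖fourierCoeff (fun x => (g x : ℂ)) k‖ ^ 2)
      (∫ x, g x * g x ∂𝕞 - ∫ x, (∫ y, circlePoissonKernel r (x - y) * g y ∂𝕞) * g x ∂𝕞) := by
  let gc : C(𝕋, ℂ) := ⟨fun x => (g x : ℂ), by fun_prop⟩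
  have hP : HasSum (fun k : ℤ => ‖fourierCoeff gc k‖ ^ 2) (∫ x, g x * g x ∂𝕞) := by
    have := hasSum_sq_fourierCoeff (ContinuousMap.toLp (E := ℂ) 2 𝕞 ℂ gc)
    simp_rw [fourierCoeff_toLp] at this
    have e : ∫ x, ‖(ContinuousMap.toLp (E := ℂ) 2 𝕞 ℂ gc) x‖ ^ 2 ∂𝕞 = ∫ x, g x * g x ∂𝕞 := by
      refine integral_congr_ae ?_
      filter_upwards [ContinuousMap.coeFn_toLp (𝕜 := ℂ) (p := 2) 𝕞 gc] with x hx
      rw [hx]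
      simp [gc, pow_two]
    rwa [e] at this
  have hQ : HasSum (fun k : ℤ => r ^ k.natAbs * ‖fourierCoeff gc k‖ ^ 2)
      (∫ x, (∫ y, circlePoissonKernel r (x - y) * g y ∂𝕞) * g x ∂𝕞) := by
    -- The pairing of P_r g with g is the zeroth Fourier coefficient of their product, taken term by
    -- term in the series of P_r g.
    have hs := ((summable_poissonIntegral h0 h1 gc).hasSum.mul_right gc).mapL (fourierCoeffCLM 0)
    have e1 : ∀ k : ℤ, fourierCoeffCLM 0
        ((((r : ℂ) ^ k.natAbs * fourierCoeff gc k) • fourier (T := 1) k) * gc) =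
        ((r ^ k.natAbs * ‖fourierCoeff gc k‖ ^ 2 : ℝ) : ℂ) := fun k => by
      have hconj : ∫ x, fourier k x * gc x ∂𝕞 = (starRingEnd ℂ) (fourierCoeff gc k) := by
        have := fourierCoeff_ofReal_neg g k
        rw [fourierCoeff, neg_neg] at this
        exact this
      have hzero : fourierCoeffCLM 0 (fourier k * gc) = ∫ x, fourier k x * gc x ∂𝕞 := by
        simp only [fourierCoeffCLM_apply, fourierCoeff, neg_zero, fourier_zero,
          ContinuousMap.mul_apply, one_smul]
      rw [smul_mul_assoc, map_smul, hzero, hconj, smul_eq_mul, mul_assoc, Complex.mul_conj']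
      push_cast
      ring
    have e2 : fourierCoeffCLM 0 ((∑' k : ℤ, ((r : ℂ) ^ k.natAbs * fourierCoeff gc k) •
        fourier (T := 1) k) * gc) =
        ((∫ x, (∫ y, circlePoissonKernel r (x - y) * g y ∂𝕞) * g x ∂𝕞 : ℝ) : ℂ) := by
      rw [← integral_complex_ofReal, fourierCoeffCLM_apply, fourierCoeff]
      refine integral_congr_ae (Filter.Eventually.of_forall fun x => ?_)
      have := poissonIntegral_apply h0 h1 gc.continuous.integrable_circle x
      rw [poissonIntegral] at this
      simp only [neg_zero, fourier_zero, ContinuousMap.mul_apply, one_smul]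
      rw [this, Complex.ofReal_mul, ← integral_complex_ofReal]
      simp [gc]
    rw [e2] at hs
    exact_mod_cast hs.congr_fun fun k => (e1 k).symm
  refine (hP.sub hQ).congr_fun fun k => ?_
  simp only [gc, ContinuousMap.coe_mk]
  ring

/-- The factor 2 counts k and -k, which contribute equally for real g; the term k = 0 vanishes and
all others are nonnegative. -/
theorem sum_one_sub_pow_mul_sq_fourierCoeff_le {r : ℝ} (h0 : 0 ≤ r) (h1 : r < 1) {g : 𝕋 → ℝ}
    (hg : Continuous g) (N : ℕ) :
    2 * ∑ n ∈ Finset.range N, (1 - r ^ (n + 1)) *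
        ‖fourierCoeff (fun x => (g x : ℂ)) ((n : ℤ) + 1)‖ ^ 2 ≤
      ∫ x, g x * g x ∂𝕞 - ∫ x, (∫ y, circlePoissonKernel r (x - y) * g y ∂𝕞) * g x ∂𝕞 := by
  have hs := (hasSum_one_sub_pow_mul_sq_fourierCoeff h0 h1 hg).nat_add_neg
  simp only [Int.natAbs_neg, Int.natAbs_natCast, Int.natAbs_zero, pow_zero, sub_self, zero_mul,
    add_zero, fourierCoeff_ofReal_neg, RCLike.norm_conj] at hs
  refine le_trans (le_of_eq ?_) (sum_le_hasSum (Finset.range (N + 1)) (fun n _ => ?_) hs)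
  · rw [Finset.sum_range_succ', Finset.mul_sum]
    simp only [pow_zero, sub_self, zero_mul, add_zero]
    refine Finset.sum_congr rfl fun n _ => ?_
    push_cast
    ring
  · have := pow_le_one₀ h0 h1.le (n := n)
    have h3 : 0 ≤ 1 - r ^ n := by linarith
    positivity

/-- This is the Cauchy–Schwarz inequality for s^(p/2-1) against 1 on [b, a], obtained from the
nonnegativity of the integral of (l - s^(p/2-1))². The integral is encoded as the increment of an
explicit primitive. -/
theorem sq_rpow_sub_rpow_le {p a b : ℝ} (hp : 1 < p) (ha : 0 < a) (hb : 0 < b) :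
    4 * (p - 1) / p ^ 2 * ((a ^ (p / 2) - b ^ (p / 2)) * (a ^ (p / 2) - b ^ (p / 2))) ≤
      (a - b) * (a ^ (p - 1) - b ^ (p - 1)) := by
  wlog hab : b < a generalizing a b
  · rcases (not_lt.1 hab).eq_or_lt with rfl | h
    · simp
    · have := this hb ha h
      linarith
  have hmono : ∀ l : ℝ, MonotoneOn (fun s : ℝ => l ^ 2 * s - 2 * l * (2 / p) * s ^ (p / 2) +
      1 / (p - 1) * s ^ (p - 1)) (Set.Ioi 0) := by
    intro l
    have hd : ∀ s : ℝ, 0 < s → HasDerivAt (fun s : ℝ => l ^ 2 * s - 2 * l * (2 / p) * s ^ (p / 2) +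
      1 / (p - 1) * s ^ (p - 1)) ((l - s ^ (p / 2 - 1)) ^ 2) s := fun s hs => by
      have h := (((hasDerivAt_id s).const_mul (l ^ 2)).sub
        ((Real.hasDerivAt_rpow_const (p := p / 2) (Or.inl hs.ne')).const_mul (2 * l * (2 / p)))).add
        ((Real.hasDerivAt_rpow_const (p := p - 1) (Or.inl hs.ne')).const_mul (1 / (p - 1)))
      refine h.congr_deriv ?_
      have e : s ^ (p - 1 - 1) = s ^ (p / 2 - 1) * s ^ (p / 2 - 1) := by
        rw [← Real.rpow_add hs]; congr 1; ring
      rw [e]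
      have : p - 1 ≠ 0 := by linarith
      field_simp
      ring
    refine monotoneOn_of_deriv_nonneg (convex_Ioi 0)
      (fun s hs => (hd s hs).continuousAt.continuousWithinAt) ?_ ?_
    all_goals
      intro s hs
      rw [interior_Ioi] at hs
    · exact (hd s hs).differentiableAt.differentiableWithinAt
    · rw [(hd s hs).deriv]
      positivity
  have hd : 0 < a - b := by linarith
  set D := a ^ (p / 2) - b ^ (p / 2)
  -- The optimal l is the mean of s^(p/2-1) over [b, a].
  have key := hmono (2 / p * D / (a - b)) hb ha hab.le
  simp only at key
  have key2 : 0 ≤ (2 / p * D / (a - b)) ^ 2 * (a - b) - 2 * (2 / p * D / (a - b)) * (2 / p) * D +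
      1 / (p - 1) * (a ^ (p - 1) - b ^ (p - 1)) := by
    simp only [D] at key ⊢
    linarith
  have hp1 : 0 < p - 1 := by linarith
  have key3 := mul_nonneg key2 (mul_pos hd hp1).le
  have e : ((2 / p * D / (a - b)) ^ 2 * (a - b) - 2 * (2 / p * D / (a - b)) * (2 / p) * D +
      1 / (p - 1) * (a ^ (p - 1) - b ^ (p - 1))) * ((a - b) * (p - 1)) =
      (a - b) * (a ^ (p - 1) - b ^ (p - 1)) - 4 * (p - 1) / p ^ 2 * (D * D) := by
    field_simp
    ring
  linarith

/-- `∑_{k ∈ S} Re (c_k e_k)`. -/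
noncomputable def trigPoly (S : Finset ℤ) (c : ℤ → ℂ) (x : 𝕋) : ℝ :=
  ∑ k ∈ S, (c k * fourier k x).re

theorem continuous_trigPoly (S : Finset ℤ) (c : ℤ → ℂ) : Continuous (trigPoly S c) := by
  unfold trigPoly
  fun_prop

/-- The multiplier r^|k| is real, hence commutes with taking real parts, so the coefficients need no
conjugate symmetry. -/
theorem integral_circlePoissonKernel_mul_trigPoly {r : ℝ} (h0 : 0 ≤ r) (h1 : r < 1)
    (S : Finset ℤ) (c : ℤ → ℂ) (x : 𝕋) :
    ∫ y, circlePoissonKernel r (x - y) * trigPoly S c y ∂𝕞 =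
      trigPoly S (fun k => (r : ℂ) ^ k.natAbs * c k) x := by
  have hK := continuous_circlePoissonKernel h0 h1
  simp_rw [trigPoly, Finset.mul_sum]
  rw [integral_finsetSum _ fun k _ => Continuous.integrable_circle (by fun_prop)]
  refine Finset.sum_congr rfl fun k _ => ?_
  have := re_poissonIntegral_apply h0 h1 (f := c k • ⇑(fourier (T := 1) k))
    (by fun_prop) x
  rw [poissonIntegral_smul, poissonIntegral_fourier] at this
  simp only [Pi.smul_apply, smul_eq_mul, ContinuousMap.smul_apply] at this
  rw [← this]
  ring_nf

/-- The Stroock–Varopoulos inequality for the Poisson semigroup on the circle. -/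
theorem stroock_varopoulos_trigPoly (S : Finset ℤ) (c : ℤ → ℂ) {p : ℝ} (hp : 1 < p)
    (hpos : ∀ x, 0 < trigPoly S c x) (N : ℕ) :
    4 * (p - 1) / p ^ 2 * (2 * ∑ n ∈ Finset.range N, ((n : ℝ) + 1) *
        ‖fourierCoeff (fun x => ((trigPoly S c x ^ (p / 2) : ℝ) : ℂ)) ((n : ℤ) + 1)‖ ^ 2) ≤
      ∫ x, trigPoly S (fun k => (k.natAbs : ℂ) * c k) x * trigPoly S c x ^ (p - 1) ∂𝕞 := by
  set u := trigPoly S c with hu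
  have hcu : Continuous u := continuous_trigPoly S c
  have hcg : Continuous fun x => u x ^ (p / 2) :=
    hcu.rpow_const fun x => Or.inl (hpos x).ne'
  have hch : Continuous fun x => u x ^ (p - 1) :=
    hcu.rpow_const fun x => Or.inl (hpos x).ne'
  set C := 4 * (p - 1) / p ^ 2
  have hC : 0 ≤ C := by
    have : 0 < p - 1 := by linarith
    positivity
  set m : ℤ → ℝ := fun k => ∫ x, (c k * fourier k x).re * u x ^ (p - 1) ∂𝕞
  set w : ℕ → ℝ := fun n => ‖fourierCoeff (fun x => ((u x ^ (p / 2) : ℝ) : ℂ)) ((n : ℤ) + 1)‖ ^ 2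
  have hm : ∀ v : ℤ → ℝ, ∫ x, trigPoly S (fun k => (v k : ℂ) * c k) x * u x ^ (p - 1) ∂𝕞 =
      ∑ k ∈ S, v k * m k := fun v => by
    simp_rw [trigPoly, Finset.sum_mul]
    rw [integral_finsetSum _ fun k _ => Continuous.integrable_circle (by fun_prop)]
    refine Finset.sum_congr rfl fun k _ => ?_
    rw [← integral_const_mul]
    simp_rw [mul_assoc, Complex.re_ofReal_mul, mul_assoc]
  -- The inequality for 1 - P_r divided by 1 - r: each (1 - r^m)/(1 - r) is a geometric sum, a
  -- polynomial in r whose value at r = 1 is m. Letting r → 1 produces the generator.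
  have key : ∀ r ∈ Set.Ico (0 : ℝ) 1,
      C * (2 * ∑ n ∈ Finset.range N, (∑ i ∈ Finset.range (n + 1), r ^ i) * w n) ≤
        ∑ k ∈ S, (∑ i ∈ Finset.range k.natAbs, r ^ i) * m k := by
    rintro r ⟨h0, h1⟩
    have hK := continuous_circlePoissonKernel h0 h1
    have d1 := integral_circlePoissonKernel_mul_sub_mul_sub h0 h1 hcg hcg
    have d2 := integral_circlePoissonKernel_mul_sub_mul_sub h0 h1 hcu hch
    have cint : ∀ F : 𝕋 → 𝕋 → ℝ, Continuous F.uncurry → Continuous fun x => ∫ y, F x y ∂𝕞 := by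
      intro F hF
      simpa using continuous_parametric_integral_of_continuous (μ := 𝕞) hF isCompact_univ
    have d3 : C * ∫ x, ∫ y, circlePoissonKernel r (x - y) *
        ((u x ^ (p / 2) - u y ^ (p / 2)) * (u x ^ (p / 2) - u y ^ (p / 2))) ∂𝕞 ∂𝕞 ≤
        ∫ x, ∫ y, circlePoissonKernel r (x - y) *
          ((u x - u y) * (u x ^ (p - 1) - u y ^ (p - 1))) ∂𝕞 ∂𝕞 := by
      rw [← integral_const_mul]
      refine integral_mono (Continuous.integrable_circle (continuous_const.mul (cint (fun x y =>
          circlePoissonKernel r (x - y) *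
          ((u x ^ (p / 2) - u y ^ (p / 2)) * (u x ^ (p / 2) - u y ^ (p / 2)))) ?_)))
        (Continuous.integrable_circle (cint (fun x y => circlePoissonKernel r (x - y) *
          ((u x - u y) * (u x ^ (p - 1) - u y ^ (p - 1)))) ?_)) fun x => ?_
      · exact (hK.comp (continuous_fst.sub continuous_snd)).mul
          (((hcg.comp continuous_fst).sub (hcg.comp continuous_snd)).mul
            ((hcg.comp continuous_fst).sub (hcg.comp continuous_snd)))
      · exact (hK.comp (continuous_fst.sub continuous_snd)).mul
          (((hcu.comp continuous_fst).sub (hcu.comp continuous_snd)).mul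
            ((hch.comp continuous_fst).sub (hch.comp continuous_snd)))
      · simp only
        rw [← integral_const_mul]
        refine integral_mono (Continuous.integrable_circle (by fun_prop))
          (Continuous.integrable_circle (by fun_prop)) fun y => ?_
        have := mul_le_mul_of_nonneg_left (sq_rpow_sub_rpow_le hp (hpos x) (hpos y))
          (circlePoissonKernel_nonneg h0 h1 (x - y))
        simp only
        linarith
    rw [d1, d2] at d3
    have d4 := mul_le_mul_of_nonneg_left (sum_one_sub_pow_mul_sq_fourierCoeff_le h0 h1 hcg N) hC
    have d5 : ∫ x, u x * u x ^ (p - 1) ∂𝕞 -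
        ∫ x, (∫ y, circlePoissonKernel r (x - y) * u y ∂𝕞) * u x ^ (p - 1) ∂𝕞 =
        ∑ k ∈ S, (1 - r ^ k.natAbs) * m k := by
      simp_rw [hu, integral_circlePoissonKernel_mul_trigPoly h0 h1, ← hu]
      have e1 := hm fun _ => 1
      have e2 := hm fun k => r ^ k.natAbs
      simp only [Complex.ofReal_one, one_mul, Complex.ofReal_pow] at e1 e2
      rw [e2]
      rw [show (trigPoly S fun k => c k) = u from rfl] at e1
      rw [e1, ← Finset.sum_sub_distrib]
      exact Finset.sum_congr rfl fun k _ => by ring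
    rw [d5] at d3
    have hr : 0 < 1 - r := by linarith
    have hg : ∀ n : ℕ, 1 - r ^ n = (1 - r) * ∑ i ∈ Finset.range n, r ^ i := fun n => by
      rw [mul_comm, geom_sum_mul_neg]
    refine le_of_mul_le_mul_left ?_ hr
    calc (1 - r) * (C * (2 * ∑ n ∈ Finset.range N, (∑ i ∈ Finset.range (n + 1), r ^ i) * w n))
        = C * (2 * ∑ n ∈ Finset.range N, (1 - r ^ (n + 1)) * w n) := by
          simp_rw [hg, mul_assoc]
          rw [← Finset.mul_sum]
          ring
      _ ≤ _ := d4
      _ ≤ ∑ k ∈ S, (1 - r ^ k.natAbs) * m k := by linarith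
      _ = (1 - r) * ∑ k ∈ S, (∑ i ∈ Finset.range k.natAbs, r ^ i) * m k := by
          simp_rw [hg, mul_assoc]
          rw [← Finset.mul_sum]
  have lim := ContinuousWithinAt.closure_le (x := (1 : ℝ)) (s := Set.Ico 0 1)
    (by rw [closure_Ico (by norm_num)]; exact Set.right_mem_Icc.2 zero_le_one)
    (Continuous.continuousWithinAt (by fun_prop)) (Continuous.continuousWithinAt (by fun_prop)) key
  have := hm fun k => (k.natAbs : ℝ)
  simp only [Complex.ofReal_natCast] at this
  rw [this]
  simpa using lim

/-! ### The entropy inequality for powers -/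

theorem integral_rpow_pos {u : 𝕋 → ℝ} (hu : Continuous u) (hpos : ∀ x, 0 < u x) (p : ℝ) :
    0 < ∫ x, u x ^ p ∂𝕞 := by
  have hc : Continuous fun x => u x ^ p := hu.rpow_const fun x => Or.inl (hpos x).ne'
  have hcp : ∀ x, 0 < u x ^ p := fun x => Real.rpow_pos_of_pos (hpos x) p
  refine (integral_pos_iff_support_of_nonneg (fun x => (hcp x).le) hc.integrable_circle).2 ?_
  have : Function.support (fun x => u x ^ p) = Set.univ :=
    Set.eq_univ_of_forall fun x => (hcp x).ne'
  rw [this, measure_univ]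
  exact one_pos

/-- The `L_p`-version of the logarithmic Sobolev inequality. -/
theorem entropy_rpow_trigPoly_le (S : Finset ℤ) (c : ℤ → ℂ) {p : ℝ} (hp : 1 < p)
    (hpos : ∀ x, 0 < trigPoly S c x) :
    2 * (p - 1) * (∫ x, trigPoly S c x ^ p * Real.log (trigPoly S c x ^ p) ∂𝕞 -
      (∫ x, trigPoly S c x ^ p ∂𝕞) * Real.log (∫ x, trigPoly S c x ^ p ∂𝕞)) ≤
      p ^ 2 * ∫ x, trigPoly S (fun k => (k.natAbs : ℂ) * c k) x * trigPoly S c x ^ (p - 1) ∂𝕞 := by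
  have hp1 : 0 < p - 1 := by linarith
  have hsv := stroock_varopoulos_trigPoly S c hp hpos
  set D := ∫ x, trigPoly S (fun k => (k.natAbs : ℂ) * c k) x * trigPoly S c x ^ (p - 1) ∂𝕞
  have hcu := continuous_trigPoly S c
  let g : C(𝕋, ℝ) := ⟨fun x => trigPoly S c x ^ (p / 2),
    hcu.rpow_const fun x => Or.inl (hpos x).ne'⟩
  have hg2 : ∀ x, g x ^ 2 = trigPoly S c x ^ p := fun x => by
    change (trigPoly S c x ^ (p / 2)) ^ 2 = _
    rw [← Real.rpow_natCast, ← Real.rpow_mul (hpos x).le]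
    congr 1
    push_cast
    ring
  -- The energy bound B for g = u^(p/2) is the Stroock–Varopoulos inequality solved for the energy
  -- of g.
  have key := logSobolev_circle g (fun x => Real.rpow_nonneg (hpos x).le _)
    (by simp_rw [hg2]; exact integral_rpow_pos hcu hpos p) (B := p ^ 2 / (4 * (p - 1)) * D)
    fun N => by
      have := mul_le_mul_of_nonneg_left (hsv N) (show 0 ≤ p ^ 2 / (4 * (p - 1)) by positivity)
      refine le_trans (le_of_eq ?_) this
      have : p ^ 2 / (4 * (p - 1)) * (4 * (p - 1) / p ^ 2) = 1 := by field_simp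
      rw [← mul_assoc, this, one_mul]
      rfl
  simp_rw [hg2] at key
  have := mul_le_mul_of_nonneg_left key (show 0 ≤ 2 * (p - 1) by positivity)
  refine this.trans_eq ?_
  field_simp
  ring

/-! ### The Poisson flow and the monotonicity of norms with growing exponent -/

/-- The evolution of a trigonometric polynomial under the Poisson semigroup. -/
noncomputable def trigFlow (S : Finset ℤ) (a : ℤ → ℂ) (t : ℝ) : 𝕋 → ℝ :=
  trigPoly S fun k => (Real.exp (-t) : ℂ) ^ k.natAbs * a k

theorem trigFlow_eq (S : Finset ℤ) (a : ℤ → ℂ) (t : ℝ) (x : 𝕋) :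
    trigFlow S a t x = ∑ k ∈ S, Real.exp (-t) ^ k.natAbs * (a k * fourier k x).re := by
  unfold trigFlow trigPoly
  refine Finset.sum_congr rfl fun k _ => ?_
  rw [mul_assoc, ← Complex.ofReal_pow, Complex.re_ofReal_mul]

theorem trigFlow_zero (S : Finset ℤ) (a : ℤ → ℂ) : trigFlow S a 0 = trigPoly S a := by
  unfold trigFlow
  simp

/-- Minimum principle: the flow averages the initial datum against a probability kernel. It keeps
the flow positive, so that real powers and logarithms stay smooth. -/
theorem le_trigFlow {S : Finset ℤ} {a : ℤ → ℂ} {ε : ℝ} (h : ∀ x, ε ≤ trigPoly S a x) {t : ℝ}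
    (ht : 0 ≤ t) (x : 𝕋) : ε ≤ trigFlow S a t x := by
  rcases ht.eq_or_lt with rfl | ht
  · rw [trigFlow_zero]; exact h x
  have h0 := (Real.exp_pos (-t)).le
  have h1 : Real.exp (-t) < 1 := by
    rw [← Real.exp_zero]; exact Real.exp_lt_exp.2 (by linarith)
  have hK := continuous_circlePoissonKernel h0 h1
  have hcu := continuous_trigPoly S a
  have := integral_circlePoissonKernel_mul_trigPoly h0 h1 S a x
  unfold trigFlow
  rw [← this]
  calc ε = ∫ y, circlePoissonKernel (Real.exp (-t)) (x - y) * ε ∂𝕞 := by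
        rw [integral_mul_const, integral_circlePoissonKernel_sub h0 h1, one_mul]
    _ ≤ _ := by
        refine integral_mono (Continuous.integrable_circle (by fun_prop))
          (Continuous.integrable_circle (by fun_prop)) fun y => ?_
        exact mul_le_mul_of_nonneg_left (h y) (circlePoissonKernel_nonneg h0 h1 _)

theorem continuous_uncurry_trigFlow (S : Finset ℤ) (a : ℤ → ℂ) :
    Continuous fun z : ℝ × 𝕋 => trigFlow S a z.1 z.2 := by
  simp_rw [trigFlow_eq]
  fun_prop

/-- The image of `trigFlow` under the generator `∑ c_k e_k ↦ ∑ |k| c_k e_k`. -/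
noncomputable def trigFlowGen (S : Finset ℤ) (a : ℤ → ℂ) (t : ℝ) : 𝕋 → ℝ :=
  trigPoly S fun k => (k.natAbs : ℂ) * ((Real.exp (-t) : ℂ) ^ k.natAbs * a k)

theorem trigFlowGen_eq (S : Finset ℤ) (a : ℤ → ℂ) (t : ℝ) (x : 𝕋) :
    trigFlowGen S a t x =
      ∑ k ∈ S, k.natAbs * Real.exp (-t) ^ k.natAbs * (a k * fourier k x).re := by
  unfold trigFlowGen trigPoly
  refine Finset.sum_congr rfl fun k _ => ?_
  rw [show (k.natAbs : ℂ) * ((Real.exp (-t) : ℂ) ^ k.natAbs * a k) * fourier k x =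
    ((k.natAbs * Real.exp (-t) ^ k.natAbs : ℝ) : ℂ) * (a k * fourier k x) by push_cast; ring,
    Complex.re_ofReal_mul]

theorem continuous_uncurry_trigFlowGen (S : Finset ℤ) (a : ℤ → ℂ) :
    Continuous fun z : ℝ × 𝕋 => trigFlowGen S a z.1 z.2 := by
  simp_rw [trigFlowGen_eq]
  fun_prop

theorem hasDerivAt_trigFlow (S : Finset ℤ) (a : ℤ → ℂ) (t : ℝ) (x : 𝕋) :
    HasDerivAt (fun s => trigFlow S a s x) (-trigFlowGen S a t x) t := by
  simp_rw [trigFlow_eq]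
  rw [trigFlowGen_eq, ← Finset.sum_neg_distrib]
  refine HasDerivAt.fun_sum fun k _ => ?_
  have h : ∀ s : ℝ, Real.exp (-s) ^ k.natAbs = Real.exp (-s * k.natAbs) := fun s => by
    rw [← Real.exp_nat_mul, mul_comm]
  simp_rw [h]
  have h1 := (((hasDerivAt_id t).neg.mul_const (k.natAbs : ℝ)).exp).mul_const
    (a k * fourier k x).re
  refine h1.congr_deriv ?_
  simp only [Pi.neg_apply, id]
  ring

theorem trigFlow_pos {S : Finset ℤ} {a : ℤ → ℂ}
    (hpos : ∀ x, 0 < trigPoly S a x) {t : ℝ} (ht : 0 ≤ t) (x : 𝕋) : 0 < trigFlow S a t x := by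
  obtain ⟨y, hy⟩ := (continuous_trigPoly S a).exists_forall_le_of_hasCompactSupport
    (HasCompactSupport.of_compactSpace _)
  exact (hpos y).trans_le (le_trigFlow hy ht x)

/-- Derivative of `∫ u_s ^ q(s)` along the Poisson flow, for a time-dependent exponent `q`. -/
theorem hasDerivAt_integral_trigFlow_rpow {S : Finset ℤ} {a : ℤ → ℂ}
    (hpos : ∀ x, 0 < trigPoly S a x) {q : ℝ → ℝ} {q' : ℝ → ℝ} (hq : Continuous q)
    (hq' : Continuous q') (hd : ∀ t, HasDerivAt q (q' t) t) {t : ℝ} (ht : 0 < t) :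
    HasDerivAt (fun s => ∫ x, trigFlow S a s x ^ q s ∂𝕞)
      (∫ x, (-trigFlowGen S a t x * q t * trigFlow S a t x ^ (q t - 1) +
        q' t * trigFlow S a t x ^ q t * Real.log (trigFlow S a t x)) ∂𝕞) t := by
  have hu := continuous_uncurry_trigFlow S a
  have hA := continuous_uncurry_trigFlowGen S a
  have hux : ∀ s, Continuous (trigFlow S a s) := fun s => continuous_trigPoly _ _
  have hAx : ∀ s, Continuous (trigFlowGen S a s) := fun s => continuous_trigPoly _ _
  -- On the compact time interval [t/2, t+1] the flow does not vanish, so the time derivative of the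
  -- integrand is continuous and bounded there, which justifies differentiating under the integral.
  have hne : ∀ z ∈ Set.Icc (t / 2) (t + 1) ×ˢ (Set.univ : Set 𝕋), trigFlow S a z.1 z.2 ≠ 0 :=
    fun z hz => (trigFlow_pos hpos (by linarith [hz.1.1]) _).ne'
  have hcont : ContinuousOn (fun z : ℝ × 𝕋 => -trigFlowGen S a z.1 z.2 * q z.1 *
      trigFlow S a z.1 z.2 ^ (q z.1 - 1) +
      q' z.1 * trigFlow S a z.1 z.2 ^ q z.1 * Real.log (trigFlow S a z.1 z.2))
      (Set.Icc (t / 2) (t + 1) ×ˢ Set.univ) := by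
    have h1 : ContinuousOn (fun z : ℝ × 𝕋 => trigFlow S a z.1 z.2 ^ (q z.1 - 1))
        (Set.Icc (t / 2) (t + 1) ×ˢ Set.univ) :=
      hu.continuousOn.rpow (by fun_prop) fun z hz => Or.inl (hne z hz)
    have h2 : ContinuousOn (fun z : ℝ × 𝕋 => trigFlow S a z.1 z.2 ^ (q z.1))
        (Set.Icc (t / 2) (t + 1) ×ˢ Set.univ) :=
      hu.continuousOn.rpow (by fun_prop) fun z hz => Or.inl (hne z hz)
    have h3 : ContinuousOn (fun z : ℝ × 𝕋 => Real.log (trigFlow S a z.1 z.2))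
        (Set.Icc (t / 2) (t + 1) ×ˢ Set.univ) := hu.continuousOn.log hne
    fun_prop
  obtain ⟨M, hM⟩ := (isCompact_Icc.prod isCompact_univ).exists_bound_of_continuousOn hcont
  refine (hasDerivAt_integral_of_dominated_loc_of_deriv_le (bound := fun _ => M)
    (F' := fun s x => -trigFlowGen S a s x * q s * trigFlow S a s x ^ (q s - 1) +
        q' s * trigFlow S a s x ^ q s * Real.log (trigFlow S a s x))
    (Icc_mem_nhds (show t / 2 < t by linarith) (show t < t + 1 by linarith)) ?_ ?_ ?_ ?_
    (integrable_const M) ?_).2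
  · filter_upwards [Ioi_mem_nhds ht] with s hs
    exact ((hux s).rpow_const fun x =>
      Or.inl (trigFlow_pos hpos (le_of_lt hs) x).ne').aestronglyMeasurable
  · exact ((hux t).rpow_const fun x =>
      Or.inl (trigFlow_pos hpos ht.le x).ne').integrable_circle
  · have hn : ∀ x, trigFlow S a t x ≠ 0 := fun x => (trigFlow_pos hpos ht.le x).ne'
    have h1 := (hux t).rpow_const (p := q t - 1) fun x => Or.inl (hn x)
    have h2 := (hux t).rpow_const (p := q t) fun x => Or.inl (hn x)
    have h3 := (hux t).log hn
    have h4 := hAx t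
    exact Continuous.aestronglyMeasurable (by fun_prop)
  · exact Filter.Eventually.of_forall fun x s hs => hM (s, x) ⟨hs, trivial⟩
  · refine Filter.Eventually.of_forall fun x s hs => ?_
    exact (hasDerivAt_trigFlow S a s x).rpow (hd s) (trigFlow_pos hpos (by linarith [hs.1]) x)

theorem continuousOn_integral_trigFlow_rpow {S : Finset ℤ} {a : ℤ → ℂ}
    (hpos : ∀ x, 0 < trigPoly S a x) {q : ℝ → ℝ} (hq : Continuous q) (T : ℝ) :
    ContinuousOn (fun s => ∫ x, trigFlow S a s x ^ q s ∂𝕞) (Set.Icc 0 T) := by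
  have hu := continuous_uncurry_trigFlow S a
  have hux : ∀ s, Continuous (trigFlow S a s) := fun s => continuous_trigPoly _ _
  have hne : ∀ z ∈ Set.Icc 0 T ×ˢ (Set.univ : Set 𝕋), trigFlow S a z.1 z.2 ≠ 0 :=
    fun z hz => (trigFlow_pos hpos hz.1.1 _).ne'
  have h2 : ContinuousOn (fun z : ℝ × 𝕋 => trigFlow S a z.1 z.2 ^ (q z.1))
      (Set.Icc 0 T ×ˢ Set.univ) :=
    hu.continuousOn.rpow (by fun_prop) fun z hz => Or.inl (hne z hz)
  obtain ⟨M, hM⟩ := (isCompact_Icc.prod isCompact_univ).exists_bound_of_continuousOn h2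
  refine continuousOn_of_dominated (bound := fun _ => M) (fun s hs => ?_) (fun s hs => ?_)
    (integrable_const M) ?_
  · exact ((hux s).rpow_const fun x =>
      Or.inl (trigFlow_pos hpos hs.1 x).ne').aestronglyMeasurable
  · exact Filter.Eventually.of_forall fun x => hM (s, x) ⟨hs, trivial⟩
  · refine Filter.Eventually.of_forall fun x => ?_
    exact h2.comp (f := fun s => (s, x)) (by fun_prop) fun s hs => ⟨hs, trivial⟩

/-- Hypercontractivity for positive trigonometric polynomials. -/
theorem log_integral_trigFlow_rpow_le {S : Finset ℤ} {a : ℤ → ℂ}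
    (hpos : ∀ x, 0 < trigPoly S a x) {p : ℝ} (hp : 1 < p) {t : ℝ} (ht : 0 ≤ t) :
    Real.log (∫ x, trigFlow S a t x ^ (1 + (p - 1) * Real.exp (2 * t)) ∂𝕞) /
        (1 + (p - 1) * Real.exp (2 * t)) ≤
      Real.log (∫ x, trigPoly S a x ^ p ∂𝕞) / p := by
  have hp1 : 0 < p - 1 := by linarith
  set q : ℝ → ℝ := fun s => 1 + (p - 1) * Real.exp (2 * s) with hq
  have hq1 : ∀ s, 1 < q s := fun s => by
    have := Real.exp_pos (2 * s)
    simp only [hq]; nlinarith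
  -- The exponent solves q' = 2(q-1), the equation that matches the factor 2(q-1) of the entropy
  -- inequality.
  have hqd : ∀ s, HasDerivAt q (2 * (q s - 1)) s := fun s => by
    have := ((((hasDerivAt_id s).const_mul 2).exp).const_mul (p - 1)).const_add 1
    refine this.congr_deriv ?_
    simp [hq]; ring
  have hqc : Continuous q := by fun_prop
  have hFpos : ∀ s, 0 ≤ s → 0 < ∫ x, trigFlow S a s x ^ q s ∂𝕞 := fun s hs =>
    integral_rpow_pos (continuous_trigPoly _ _) (trigFlow_pos hpos hs) _
  have hmain : AntitoneOn (fun s => Real.log (∫ x, trigFlow S a s x ^ q s ∂𝕞) / q s)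
      (Set.Icc 0 t) := by
    have hder : ∀ s ∈ Set.Ioo 0 t, ∃ d ≤ 0, HasDerivAt
        (fun s => Real.log (∫ x, trigFlow S a s x ^ q s ∂𝕞) / q s) d s := by
      intro s hs
      have hn : ∀ x, 0 < trigFlow S a s x := trigFlow_pos hpos hs.1.le
      have hF := hasDerivAt_integral_trigFlow_rpow hpos hqc (q' := fun s => 2 * (q s - 1))
        (by fun_prop) hqd hs.1
      have hφ := (hF.log (hFpos s hs.1.le).ne').div (hqd s) (by linarith [hq1 s])
      refine ⟨_, ?_, hφ⟩
      have ent := entropy_rpow_trigPoly_le S (fun k => (Real.exp (-s) : ℂ) ^ k.natAbs * a k)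
        (hq1 s) hn
      have hux : Continuous (trigFlow S a s) := continuous_trigPoly _ _
      have hAx : Continuous (trigFlowGen S a s) := continuous_trigPoly _ _
      have h1 := hux.rpow_const (p := q s - 1) fun x => Or.inl (hn x).ne'
      have h2 := hux.rpow_const (p := q s) fun x => Or.inl (hn x).ne'
      have h3 := hux.log fun x => (hn x).ne'
      have hsplit : ∫ x, (-trigFlowGen S a s x * q s * trigFlow S a s x ^ (q s - 1) +
          2 * (q s - 1) * trigFlow S a s x ^ q s * Real.log (trigFlow S a s x)) ∂𝕞 =
          -q s * ∫ x, trigFlowGen S a s x * trigFlow S a s x ^ (q s - 1) ∂𝕞 +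
          2 * (q s - 1) / q s *
            ∫ x, trigFlow S a s x ^ q s * Real.log (trigFlow S a s x ^ q s) ∂𝕞 := by
        rw [integral_add, ← integral_const_mul, ← integral_const_mul]
        · congr 1
          · refine integral_congr_ae (Filter.Eventually.of_forall fun x => ?_)
            simp only
            ring
          · refine integral_congr_ae (Filter.Eventually.of_forall fun x => ?_)
            simp only
            rw [Real.log_rpow (hn x)]
            have : q s ≠ 0 := by linarith [hq1 s]
            field_simp
        all_goals exact Continuous.integrable_circle (by fun_prop)
      rw [hsplit]
      change 2 * (q s - 1) * (∫ x, trigFlow S a s x ^ q s *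
        Real.log (trigFlow S a s x ^ q s) ∂𝕞 - (∫ x, trigFlow S a s x ^ q s ∂𝕞) *
        Real.log (∫ x, trigFlow S a s x ^ q s ∂𝕞)) ≤
        q s ^ 2 * ∫ x, trigFlowGen S a s x * trigFlow S a s x ^ (q s - 1) ∂𝕞 at ent
      have hFs := hFpos s hs.1.le
      have hqs : 0 < q s := by linarith [hq1 s]
      generalize ∫ x, trigFlow S a s x ^ q s * Real.log (trigFlow S a s x ^ q s) ∂𝕞 = L at *
      generalize ∫ x, trigFlowGen S a s x * trigFlow S a s x ^ (q s - 1) ∂𝕞 = D at *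
      generalize ∫ x, trigFlow S a s x ^ q s ∂𝕞 = F at *
      refine div_nonpos_of_nonpos_of_nonneg ?_ (by positivity)
      -- The numerator of the derivative of log F / q is the difference of the two sides of the
      -- entropy inequality, divided by F.
      have e : (-q s * D + 2 * (q s - 1) / q s * L) / F * q s - Real.log F * (2 * (q s - 1)) =
          (2 * (q s - 1) * (L - F * Real.log F) - q s ^ 2 * D) / F := by
        field_simp
        ring
      rw [e]
      exact div_nonpos_of_nonpos_of_nonneg (by linarith) hFs.le
    refine antitoneOn_of_deriv_nonpos (convex_Icc 0 t) ?_ ?_ ?_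
    · exact ((continuousOn_integral_trigFlow_rpow hpos hqc t).log
        fun s hs => (hFpos s hs.1).ne').div hqc.continuousOn fun s _ => by linarith [hq1 s]
    all_goals
      intro s hs
      rw [interior_Icc] at hs
      obtain ⟨d, hd, hφ⟩ := hder s hs
    · exact hφ.differentiableAt.differentiableWithinAt
    · rw [hφ.deriv]; exact hd
  have := hmain (Set.left_mem_Icc.2 ht) (Set.right_mem_Icc.2 ht) ht
  simpa [hq, trigFlow_zero] using this

theorem integral_trigFlow_rpow_rpow_le {S : Finset ℤ} {a : ℤ → ℂ}
    (hpos : ∀ x, 0 < trigPoly S a x) {p : ℝ} (hp : 1 < p) {t : ℝ} (ht : 0 ≤ t) :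
    (∫ x, trigFlow S a t x ^ (1 + (p - 1) * Real.exp (2 * t)) ∂𝕞) ^
        (1 + (p - 1) * Real.exp (2 * t))⁻¹ ≤ (∫ x, trigPoly S a x ^ p ∂𝕞) ^ p⁻¹ := by
  have h1 : 0 < ∫ x, trigFlow S a t x ^ (1 + (p - 1) * Real.exp (2 * t)) ∂𝕞 :=
    integral_rpow_pos (continuous_trigPoly _ _) (trigFlow_pos hpos ht) (1 + (p - 1) * Real.exp (2 * t))
  have h2 := integral_rpow_pos (continuous_trigPoly S a) hpos p
  rw [Real.rpow_def_of_pos h1, Real.rpow_def_of_pos h2]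
  exact Real.exp_le_exp.2 (log_integral_trigFlow_rpow_le hpos hp ht)

/-! ### From positive polynomials to continuous functions -/

theorem Continuous.memLp_circle {E : Type*} [NormedAddCommGroup E] {f : 𝕋 → E} (hf : Continuous f)
    (p : ℝ≥0∞) : MemLp f p 𝕞 := by
  obtain ⟨M, hM⟩ := isCompact_univ.exists_bound_of_continuousOn hf.continuousOn
  exact MemLp.of_bound
    ((hf.stronglyMeasurable_of_hasCompactSupport
      (HasCompactSupport.of_compactSpace _)).aestronglyMeasurable) M
    (Filter.Eventually.of_forall fun x => hM x trivial)

theorem eLpNorm_ofReal_eq {E : Type*} [NormedAddCommGroup E] {f : 𝕋 → E} (hf : Continuous f)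
    {p : ℝ} (hp : 0 < p) :
    eLpNorm f (ENNReal.ofReal p) 𝕞 = ENNReal.ofReal ((∫ x, ‖f x‖ ^ p ∂𝕞) ^ p⁻¹) := by
  rw [MemLp.eLpNorm_eq_integral_rpow_norm (by simpa using hp) ENNReal.ofReal_ne_top
    (hf.memLp_circle _), ENNReal.toReal_ofReal hp.le]

theorem eLpNorm_trigFlow_le {S : Finset ℤ} {a : ℤ → ℂ} (hpos : ∀ x, 0 < trigPoly S a x) {p q t : ℝ}
    (hp : 1 < p) (ht : 0 ≤ t) (hq : q ≤ 1 + (p - 1) * Real.exp (2 * t)) :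
    eLpNorm (trigFlow S a t) (ENNReal.ofReal q) 𝕞 ≤
      eLpNorm (trigPoly S a) (ENNReal.ofReal p) 𝕞 := by
  have hc1 : Continuous (trigFlow S a t) := continuous_trigPoly _ _
  have hc2 := continuous_trigPoly S a
  have h0 : 0 < 1 + (p - 1) * Real.exp (2 * t) := by
    have := Real.exp_pos (2 * t)
    nlinarith
  -- Norms increase with the exponent on a probability space, so only the extremal exponent matters.
  refine (eLpNorm_le_eLpNorm_of_exponent_le (ENNReal.ofReal_le_ofReal hq)
    (hc1.memLp_circle 0).1).trans ?_
  rw [eLpNorm_ofReal_eq hc1 h0, eLpNorm_ofReal_eq hc2 (by linarith)]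
  refine ENNReal.ofReal_le_ofReal ?_
  simp_rw [Real.norm_of_nonneg (trigFlow_pos hpos ht _).le, Real.norm_of_nonneg (hpos _).le]
  exact integral_trigFlow_rpow_rpow_le hpos hp ht

theorem exists_trigPoly_near {f : 𝕋 → ℝ} (hf : Continuous f) {ε : ℝ} (hε : 0 < ε) :
    ∃ (S : Finset ℤ) (a : ℤ → ℂ), ∀ x, |trigPoly S a x - f x| < ε := by
  let fc : C(𝕋, ℂ) := ⟨fun x => (f x : ℂ), by fun_prop⟩
  have hd : fc ∈ closure (Submodule.span ℂ (Set.range (@fourier 1)) : Set C(𝕋, ℂ)) := by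
    have := span_fourier_closure_eq_top (T := 1)
    rw [← Submodule.topologicalClosure_coe, this]; trivial
  obtain ⟨g, hg, hfg⟩ := Metric.mem_closure_iff.1 hd ε hε
  obtain ⟨c, rfl⟩ := Finsupp.mem_span_range_iff_exists_finsupp.1 hg
  refine ⟨c.support, c, fun x => ?_⟩
  have hx := (ContinuousMap.dist_apply_le_dist x).trans_lt hfg
  rw [dist_comm, dist_eq_norm] at hx
  refine lt_of_eq_of_lt ?_ ((Complex.abs_re_le_norm _).trans_lt hx)
  simp only [trigPoly, Finsupp.sum, ContinuousMap.sum_apply, ContinuousMap.smul_apply, smul_eq_mul,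
    Complex.sub_re, Complex.re_sum, fc, ContinuousMap.coe_mk, Complex.ofReal_re]

/-- Positivity of the kernel gives |P f| ≤ P|f| ≤ P u for any polynomial u ≥ |f|, which reduces
complex f to positive u. -/
theorem eLpNorm_poissonIntegral_le (f : C(𝕋, ℂ)) {p q t : ℝ} (hp : 1 < p) (ht : 0 < t)
    (hq : q ≤ 1 + (p - 1) * Real.exp (2 * t)) :
    eLpNorm (poissonIntegral (Real.exp (-t)) f) (ENNReal.ofReal q) 𝕞 ≤
      eLpNorm f (ENNReal.ofReal p) 𝕞 := by
  have h0 := (Real.exp_pos (-t)).le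
  have h1 : Real.exp (-t) < 1 := by
    rw [← Real.exp_zero]; exact Real.exp_lt_exp.2 (by linarith)
  have hK := continuous_circlePoissonKernel h0 h1
  refine ENNReal.le_of_forall_pos_le_add fun ε hε _ => ?_
  have hε' : (0 : ℝ) < ε / 3 := by positivity
  -- Approximating |f| + 2ε/3 within ε/3 puts the polynomial strictly between |f| + ε/3 and |f| + ε:
  -- positive, above |f|, and close to it.
  obtain ⟨S, a, hS⟩ := exists_trigPoly_near
    (f := fun x => ‖f x‖ + 2 * (ε / 3)) (by fun_prop) hε'
  have hlow : ∀ x, ‖f x‖ ≤ trigPoly S a x := fun x => by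
    have := (abs_lt.1 (hS x)).1; linarith
  have hpos : ∀ x, 0 < trigPoly S a x := fun x => by
    have := (abs_lt.1 (hS x)).1
    have := norm_nonneg (f x)
    linarith
  have hcu := continuous_trigPoly S a
  calc eLpNorm (poissonIntegral (Real.exp (-t)) f) (ENNReal.ofReal q) 𝕞
      ≤ eLpNorm (trigFlow S a t) (ENNReal.ofReal q) 𝕞 := by
        refine eLpNorm_mono fun x => ?_
        rw [Real.norm_of_nonneg (trigFlow_pos hpos ht.le x).le]
        refine (norm_poissonIntegral_apply_le h0 h1 f.continuous.integrable_circle x).trans ?_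
        rw [trigFlow, ← integral_circlePoissonKernel_mul_trigPoly h0 h1]
        refine integral_mono (Continuous.integrable_circle (by fun_prop))
          (Continuous.integrable_circle (by fun_prop)) fun y => ?_
        exact mul_le_mul_of_nonneg_left (hlow y) (circlePoissonKernel_nonneg h0 h1 _)
    _ ≤ eLpNorm (trigPoly S a) (ENNReal.ofReal p) 𝕞 := eLpNorm_trigFlow_le hpos hp ht.le hq
    _ ≤ eLpNorm (fun x => ‖f x‖ + (ε : ℝ)) (ENNReal.ofReal p) 𝕞 := by
        refine eLpNorm_mono fun x => ?_
        have := (abs_lt.1 (hS x)).2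
        have := norm_nonneg (f x)
        rw [Real.norm_of_nonneg (hpos x).le, Real.norm_of_nonneg (by positivity)]
        linarith
    _ ≤ eLpNorm (fun x => ‖f x‖) (ENNReal.ofReal p) 𝕞 +
          eLpNorm (fun _ => (ε : ℝ)) (ENNReal.ofReal p) 𝕞 :=
        eLpNorm_add_le (f.continuous.norm.memLp_circle 0).1 aestronglyMeasurable_const
          (by rw [← ENNReal.ofReal_one]; exact ENNReal.ofReal_le_ofReal hp.le)
    _ = eLpNorm f (ENNReal.ofReal p) 𝕞 + ε := by
        rw [eLpNorm_norm, eLpNorm_const _ (by simp; linarith) (NeZero.ne _)]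
        simp

/-! ### The Poisson operators between L_p spaces -/

section Operator

variable {p q : ℝ≥0∞} [Fact (1 ≤ p)] [Fact (1 ≤ q)]

theorem Lp.integrable_circle (f : Lp ℂ p 𝕞) : Integrable f 𝕞 := (Lp.memLp f).integrable Fact.out

theorem integral_norm_le_norm (f : Lp ℂ p 𝕞) : ∫ x, ‖f x‖ ∂𝕞 ≤ ‖f‖ := by
  rw [integral_norm_eq_lintegral_enorm (Lp.aestronglyMeasurable f), ← eLpNorm_one_eq_lintegral_enorm,
    Lp.norm_def]
  exact ENNReal.toReal_mono (Lp.eLpNorm_ne_top f)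
    (eLpNorm_le_eLpNorm_of_exponent_le Fact.out (Lp.aestronglyMeasurable f))

/-- The Poisson integral as a bounded operator from `L_p` to continuous functions. -/
noncomputable def poissonCLM (p : ℝ≥0∞) [Fact (1 ≤ p)] {r : ℝ} (h0 : 0 ≤ r) (h1 : r < 1) :
    Lp ℂ p 𝕞 →L[ℂ] C(𝕋, ℂ) :=
  LinearMap.mkContinuous
    { toFun := fun f => poissonIntegral r f
      map_add' := fun f g => by
        rw [← poissonIntegral_add h0 h1 (Lp.integrable_circle f) (Lp.integrable_circle g)]
        unfold poissonIntegral
        rw [fourierCoeff_congr_ae (Lp.coeFn_add f g)]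
      map_smul' := fun c f => by
        rw [RingHom.id_apply, ← poissonIntegral_smul]
        unfold poissonIntegral
        rw [fourierCoeff_congr_ae (Lp.coeFn_smul c f)] }
    (∑' k : ℤ, r ^ k.natAbs) fun f => by
      refine (norm_poissonIntegral_le h0 h1 f).trans ?_
      have : 0 ≤ ∑' k : ℤ, r ^ k.natAbs := tsum_nonneg fun k => by positivity
      exact mul_le_mul_of_nonneg_left (integral_norm_le_norm f) this

theorem poissonCLM_apply {r : ℝ} (h0 : 0 ≤ r) (h1 : r < 1) (f : Lp ℂ p 𝕞) :
    poissonCLM p h0 h1 f = poissonIntegral r f := rfl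

theorem exp_neg_mul_abs (t : ℝ) (k : ℤ) :
    Real.exp (-t * |(k : ℝ)|) = Real.exp (-t) ^ k.natAbs := by
  rw [← Real.exp_nat_mul, mul_comm, Nat.cast_natAbs, Int.cast_abs]

theorem isPoissonOperator_comp_poissonCLM {t : ℝ} (h1 : Real.exp (-t) < 1) :
    IsPoissonOperator t ((ContinuousMap.toLp (E := ℂ) q 𝕞 ℂ).comp
      (poissonCLM p (Real.exp_pos (-t)).le h1)) := by
  intro f k
  rw [ContinuousLinearMap.comp_apply, fourierCoeff_congr_ae (ContinuousMap.coeFn_toLp 𝕞 _),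
    poissonCLM_apply, fourierCoeff_poissonIntegral (Real.exp_pos (-t)).le h1, exp_neg_mul_abs,
    Complex.ofReal_pow]

/-- This evaluates an arbitrary Poisson operator on a continuous function once a continuous
candidate has the right Fourier coefficients. -/
theorem IsPoissonOperator.toLp_eq {t : ℝ} {T : Lp ℂ p 𝕞 →L[ℂ] Lp ℂ q 𝕞}
    (hT : IsPoissonOperator t T) (f g : C(𝕋, ℂ))
    (h : ∀ k, fourierCoeff g k = (Real.exp (-t) : ℂ) ^ k.natAbs * fourierCoeff f k) :
    T (ContinuousMap.toLp p 𝕞 ℂ f) = ContinuousMap.toLp q 𝕞 ℂ g := by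
  have hz : ⇑(T (ContinuousMap.toLp p 𝕞 ℂ f)) - ⇑g =ᵐ[𝕞] 0 := by
    have hi := Lp.integrable_circle (T (ContinuousMap.toLp p 𝕞 ℂ f))
    have hj := g.continuous.integrable_circle
    refine ae_eq_zero_of_fourierCoeff_eq_zero (hi.sub hj) fun k => ?_
    have e := hT (ContinuousMap.toLp p 𝕞 ℂ f) k
    rw [fourierCoeff_congr_ae (ContinuousMap.coeFn_toLp 𝕞 f), exp_neg_mul_abs, Complex.ofReal_pow,
      ← h] at e
    simp only [fourierCoeff] at e ⊢
    simp only [Pi.sub_apply, smul_sub]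
    rw [integral_sub (hi.fourier_smul _) (hj.fourier_smul _), e, sub_self]
  refine Lp.ext ?_
  filter_upwards [hz, ContinuousMap.coeFn_toLp (p := q) (𝕜 := ℂ) 𝕞 g] with x hx hg
  rw [hg]
  exact sub_eq_zero.1 hx

theorem one_le_norm_of_isPoissonOperator {t : ℝ} {T : Lp ℂ p 𝕞 →L[ℂ] Lp ℂ q 𝕞}
    (hT : IsPoissonOperator t T) : 1 ≤ ‖T‖ := by
  have h := hT.toLp_eq (fourier 0) (fourier 0) fun k => by
    rw [fourierCoeff_fourier_apply]
    split_ifs with hk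
    · subst hk; simp
    · simp
  have hn : ∀ (s : ℝ≥0∞) [Fact (1 ≤ s)],
      ‖ContinuousMap.toLp (E := ℂ) s 𝕞 ℂ (fourier 0)‖ = 1 := fun s hs => by
    rw [Lp.norm_def, eLpNorm_congr_ae (ContinuousMap.coeFn_toLp 𝕞 _)]
    have : (⇑(fourier (T := 1) 0) : 𝕋 → ℂ) = fun _ => 1 := funext fun _ => fourier_zero
    rw [this, eLpNorm_const _ (one_pos.trans_le hs.out).ne' (NeZero.ne _)]
    simp
  have := T.le_opNorm (ContinuousMap.toLp (E := ℂ) p 𝕞 ℂ (fourier 0))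
  rwa [h, hn, hn, mul_one] at this

end Operator

theorem norm_toLp_ofReal {p : ℝ} [Fact (1 ≤ ENNReal.ofReal p)] (hp : 0 < p) (f : C(𝕋, ℂ)) :
    ‖ContinuousMap.toLp (E := ℂ) (ENNReal.ofReal p) 𝕞 ℂ f‖ = (∫ x, ‖f x‖ ^ p ∂𝕞) ^ p⁻¹ := by
  rw [Lp.norm_def, eLpNorm_congr_ae (ContinuousMap.coeFn_toLp 𝕞 f),
    eLpNorm_ofReal_eq f.continuous hp, ENNReal.toReal_ofReal]
  exact Real.rpow_nonneg (integral_nonneg fun x => by positivity) _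

/-- Hypercontractivity of the Poisson semigroup on the circle. -/
theorem norm_comp_poissonCLM_le_one {p q t : ℝ} [Fact (1 ≤ ENNReal.ofReal p)]
    [Fact (1 ≤ ENNReal.ofReal q)] (hp : 1 < p) (ht : 0 < t)
    (hq : q ≤ 1 + (p - 1) * Real.exp (2 * t)) (h1 : Real.exp (-t) < 1) :
    ‖(ContinuousMap.toLp (E := ℂ) (ENNReal.ofReal q) 𝕞 ℂ).comp
      (poissonCLM (ENNReal.ofReal p) (Real.exp_pos (-t)).le h1)‖ ≤ 1 := by
  refine ContinuousLinearMap.opNorm_le_bound _ zero_le_one fun f => ?_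
  rw [one_mul]
  refine (ContinuousMap.toLp_denseRange ℂ 𝕞 ℂ
    (ENNReal.ofReal_ne_top (r := p))).induction_on (p := fun f => ‖((ContinuousMap.toLp (E := ℂ)
      (ENNReal.ofReal q) 𝕞 ℂ).comp (poissonCLM (ENNReal.ofReal p) (Real.exp_pos (-t)).le h1)) f‖ ≤
      ‖f‖) f (isClosed_le (by fun_prop) continuous_norm) fun g => ?_
  have e : poissonCLM (ENNReal.ofReal p) (Real.exp_pos (-t)).le h1
      (ContinuousMap.toLp (ENNReal.ofReal p) 𝕞 ℂ g) = poissonIntegral (Real.exp (-t)) g := by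
    rw [poissonCLM_apply]
    unfold poissonIntegral
    rw [fourierCoeff_congr_ae (ContinuousMap.coeFn_toLp 𝕞 g)]
  rw [ContinuousLinearMap.comp_apply, e, Lp.norm_def, Lp.norm_def,
    eLpNorm_congr_ae (ContinuousMap.coeFn_toLp 𝕞 _), eLpNorm_congr_ae (ContinuousMap.coeFn_toLp 𝕞 _)]
  exact ENNReal.toReal_mono (g.continuous.memLp_circle _).2.ne
    (eLpNorm_poissonIntegral_le g hp ht hq)

/-! ### Necessity: perturbation of the constant function -/

theorem exists_one_add_rpow_taylor (p : ℝ) : ∃ C δ : ℝ, 0 < δ ∧ ∀ s : ℝ, |s| < δ →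
    |(1 + s) ^ p - (1 + p * s + p * (p - 1) / 2 * s ^ 2)| ≤ C * |s| ^ 3 := by
  have h := (Real.one_add_rpow_hasFPowerSeriesAt_zero (a := p)).isBigO_sub_partialSum_pow 3
  obtain ⟨C, hC⟩ := h.bound
  obtain ⟨δ, hδ, hb⟩ := Metric.eventually_nhds_iff.1 hC
  refine ⟨C, δ, hδ, fun s hs => ?_⟩
  have := hb (y := s) (by simpa using hs)
  have h2 : Ring.choose p 2 = p * (p - 1) / 2 := by
    have := Ring.descPochhammer_eq_factorial_smul_choose p 2
    simp [descPochhammer_succ_right, Polynomial.smeval_mul, Polynomial.smeval_sub] at this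
    linarith
  simp [FormalMultilinearSeries.partialSum, Finset.sum_range_succ, binomialSeries,
    FormalMultilinearSeries.coeff_ofScalars, h2] at this
  convert this using 3
  ring

/-- The function `2 cos (2 π x)` on the circle. -/
noncomputable def twoCos (x : 𝕋) : ℝ := 2 * (fourier 1 x).re

theorem continuous_twoCos : Continuous twoCos := by
  unfold twoCos
  fun_prop

theorem abs_twoCos_le (x : 𝕋) : |twoCos x| ≤ 2 := by
  have := (Complex.abs_re_le_norm (fourier 1 x)).trans_eq (norm_fourier_apply 1 x)
  rw [twoCos, abs_mul, abs_two]
  linarith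

theorem integral_twoCos : ∫ x, twoCos x ∂𝕞 = 0 := by
  unfold twoCos
  rw [integral_const_mul, integral_re_circle (fourier 1).continuous, integral_fourier]
  simp

theorem integral_twoCos_sq : ∫ x, twoCos x ^ 2 ∂𝕞 = 2 := by
  have h : ∀ x, twoCos x ^ 2 = 2 * (fourier 2 x).re + 2 := fun x => by
    have h1 := norm_fourier_apply 1 x
    have h2 : (2 : ℤ) = 1 + 1 := by norm_num
    rw [h2, fourier_add, twoCos, Complex.mul_re]
    have h3 := Complex.sq_norm (fourier 1 x)
    rw [h1, Complex.normSq_apply] at h3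
    linarith
  simp_rw [h]
  rw [integral_add (Continuous.integrable_circle (by fun_prop)) (integrable_const _),
    integral_const_mul, integral_re_circle (fourier 2).continuous, integral_fourier]
  simp

/-- In the second-order Taylor expansion the linear term has mean zero and the square of `twoCos`
has mean 2; the cubic remainder is O(ε³) uniformly in x. -/
theorem tendsto_integral_one_add_mul_twoCos_rpow (p : ℝ) :
    Filter.Tendsto (fun ε => (∫ x, (1 + ε * twoCos x) ^ p ∂𝕞 - 1) / ε ^ 2)
      (nhdsWithin 0 (Set.Ioi 0)) (nhds (p * (p - 1))) := by
  obtain ⟨C, δ, hδ, hC⟩ := exists_one_add_rpow_taylor p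
  have hc := continuous_twoCos
  have hb : ∀ᶠ ε : ℝ in nhdsWithin 0 (Set.Ioi 0),
      |(∫ x, (1 + ε * twoCos x) ^ p ∂𝕞 - 1) / ε ^ 2 - p * (p - 1)| ≤ |C| * 8 * ε := by
    have hsmall : ∀ᶠ ε : ℝ in nhdsWithin 0 (Set.Ioi 0), ε < min (δ / 2) (1 / 2) :=
      nhdsWithin_le_nhds (Iio_mem_nhds (by positivity))
    filter_upwards [hsmall, self_mem_nhdsWithin] with ε h1 (h0 : 0 < ε)
    have hε1 : ε < δ / 2 := h1.trans_le (min_le_left _ _)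
    have hε2 : ε < 1 / 2 := h1.trans_le (min_le_right _ _)
    have hs : ∀ x, |ε * twoCos x| ≤ 2 * ε := fun x => by
      rw [abs_mul, abs_of_pos h0, mul_comm 2]
      exact mul_le_mul_of_nonneg_left (abs_twoCos_le x) h0.le
    have hpos : ∀ x, 1 + ε * twoCos x ≠ 0 := fun x => by
      have := (abs_le.1 (hs x)).1
      linarith
    have hcont : Continuous fun x => (1 + ε * twoCos x) ^ p :=
      Continuous.rpow_const (by fun_prop) fun x => Or.inl (hpos x)
    have hquad : ∫ x, (1 + p * (ε * twoCos x) + p * (p - 1) / 2 * (ε * twoCos x) ^ 2) ∂𝕞 =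
        1 + p * (p - 1) * ε ^ 2 := by
      simp_rw [mul_pow]
      rw [integral_add, integral_add, integral_const_mul, integral_const_mul, integral_const_mul,
        integral_const_mul, integral_twoCos, integral_twoCos_sq]
      · simp
        ring
      all_goals exact Continuous.integrable_circle (by fun_prop)
    have hdiff : |∫ x, (1 + ε * twoCos x) ^ p ∂𝕞 - (1 + p * (p - 1) * ε ^ 2)| ≤
        |C| * (2 * ε) ^ 3 := by
      rw [← hquad, ← integral_sub hcont.integrable_circle
        (Continuous.integrable_circle (by fun_prop)), ← Real.norm_eq_abs]
      refine (norm_integral_le_of_norm_le_const (C := |C| * (2 * ε) ^ 3)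
        (Filter.Eventually.of_forall fun x => ?_)).trans_eq (by simp)
      rw [Real.norm_eq_abs]
      refine (hC _ ((hs x).trans_lt (by linarith))).trans ?_
      have := hs x
      have := le_abs_self C
      gcongr
    have e : (∫ x, (1 + ε * twoCos x) ^ p ∂𝕞 - 1) / ε ^ 2 - p * (p - 1) =
        (∫ x, (1 + ε * twoCos x) ^ p ∂𝕞 - (1 + p * (p - 1) * ε ^ 2)) / ε ^ 2 := by
      field_simp
      ring
    rw [e, abs_div, abs_of_pos (show 0 < ε ^ 2 by positivity), div_le_iff₀ (by positivity)]
    linarith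
  rw [tendsto_iff_dist_tendsto_zero]
  refine squeeze_zero' (Filter.Eventually.of_forall fun _ => dist_nonneg) hb ?_
  have : Filter.Tendsto (fun ε : ℝ => |C| * 8 * ε) (nhds 0) (nhds (|C| * 8 * 0)) :=
    (continuous_const.mul continuous_id).tendsto 0
  rw [mul_zero] at this
  exact this.mono_left nhdsWithin_le_nhds

theorem mul_sq_le_of_integral_twoCos_rpow_le {p q ρ : ℝ} (hp : 0 < p) (hq : 0 < q) (hρ : 0 < ρ)
    (h : ∀ᶠ ε : ℝ in nhdsWithin 0 (Set.Ioi 0),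
      (∫ x, (1 + ε * ρ * twoCos x) ^ q ∂𝕞) ^ q⁻¹ ≤ (∫ x, (1 + ε * twoCos x) ^ p ∂𝕞) ^ p⁻¹) :
    (q - 1) * ρ ^ 2 ≤ p - 1 := by
  set A : ℝ → ℝ := fun ε => ∫ x, (1 + ε * twoCos x) ^ p ∂𝕞
  set B : ℝ → ℝ := fun ε => ∫ x, (1 + ε * ρ * twoCos x) ^ q ∂𝕞
  have hA : Filter.Tendsto (fun ε => (A ε - 1) / ε ^ 2) (nhdsWithin 0 (Set.Ioi 0))
      (nhds (p * (p - 1))) := tendsto_integral_one_add_mul_twoCos_rpow p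
  have hε2 : Filter.Tendsto (fun ε : ℝ => ε ^ 2) (nhdsWithin 0 (Set.Ioi 0)) (nhds 0) := by
    have := (continuous_pow (M := ℝ) 2).tendsto 0
    rw [zero_pow two_ne_zero] at this
    exact this.mono_left nhdsWithin_le_nhds
  have hscale : Filter.Tendsto (fun ε : ℝ => ε * ρ) (nhdsWithin 0 (Set.Ioi 0))
      (nhdsWithin 0 (Set.Ioi 0)) := by
    refine tendsto_nhdsWithin_iff.2 ⟨?_, ?_⟩
    · have : Filter.Tendsto (fun ε : ℝ => ε * ρ) (nhds 0) (nhds (0 * ρ)) :=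
        (continuous_id.mul continuous_const).tendsto 0
      rw [zero_mul] at this
      exact this.mono_left nhdsWithin_le_nhds
    · filter_upwards [self_mem_nhdsWithin] with ε hε
      exact mul_pos hε hρ
  have hB : Filter.Tendsto (fun ε => (B ε - 1) / ε ^ 2) (nhdsWithin 0 (Set.Ioi 0))
      (nhds (q * (q - 1) * ρ ^ 2)) := by
    refine (((tendsto_integral_one_add_mul_twoCos_rpow q).comp hscale).mul_const (ρ ^ 2)).congr' ?_
    filter_upwards [self_mem_nhdsWithin] with ε hε
    have : ε ≠ 0 := ne_of_gt hε
    simp only [Function.comp_apply, B]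
    field_simp
  have limit_one : ∀ (F : ℝ → ℝ) (l : ℝ), Filter.Tendsto (fun ε => (F ε - 1) / ε ^ 2)
      (nhdsWithin 0 (Set.Ioi 0)) (nhds l) →
      Filter.Tendsto F (nhdsWithin 0 (Set.Ioi 0)) (nhds 1) := by
    intro F l hF
    have := (hF.mul hε2).add_const 1
    rw [mul_zero, zero_add] at this
    refine this.congr' ?_
    filter_upwards [self_mem_nhdsWithin] with ε hε
    have : ε ≠ 0 := ne_of_gt hε
    field_simp
    ring
  have hA1 := limit_one A _ hA
  have hB1 := limit_one B _ hB
  -- Take logarithms and linearize with log A ≤ A - 1 and log B ≥ 1 - 1/B. Both bounds are exact to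
  -- first order at 1, so dividing by ε² loses nothing in the limit.
  have key : ∀ᶠ ε : ℝ in nhdsWithin 0 (Set.Ioi 0),
      q⁻¹ * (((B ε - 1) / ε ^ 2) * (B ε)⁻¹) ≤ p⁻¹ * ((A ε - 1) / ε ^ 2) := by
    filter_upwards [h, hA1.eventually (Ioi_mem_nhds one_pos), hB1.eventually (Ioi_mem_nhds one_pos),
      self_mem_nhdsWithin] with ε hε (ha : 0 < A ε) (hb : 0 < B ε) (h0 : 0 < ε)
    have h1 := Real.log_le_log (Real.rpow_pos_of_pos hb _) hε
    rw [Real.log_rpow hb, Real.log_rpow ha] at h1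
    have h2 := Real.log_le_sub_one_of_pos ha
    have h3 := Real.one_sub_inv_le_log_of_pos hb
    have h4 : q⁻¹ * (1 - (B ε)⁻¹) ≤ p⁻¹ * (A ε - 1) :=
      (mul_le_mul_of_nonneg_left h3 (by positivity)).trans
        (h1.trans (mul_le_mul_of_nonneg_left h2 (by positivity)))
    have h5 := div_le_div_of_nonneg_right h4 (sq_nonneg ε)
    refine le_trans (le_of_eq ?_) (h5.trans_eq (by ring))
    field_simp
  have lim := le_of_tendsto_of_tendsto
    ((hB.mul (hB1.inv₀ one_ne_zero)).const_mul q⁻¹) (hA.const_mul p⁻¹) key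
  rw [inv_one, mul_one] at lim
  field_simp at lim
  linarith

theorem fourierCoeff_one_add_twoCos (ε : ℝ) (k : ℤ) :
    fourierCoeff (⟨fun x => ((1 + ε * twoCos x : ℝ) : ℂ),
      Complex.continuous_ofReal.comp (continuous_const.add
        (continuous_const.mul continuous_twoCos))⟩ : C(𝕋, ℂ)) k =
      (if 0 = k then 1 else 0) + ε * ((if 1 = k then 1 else 0) + if -1 = k then 1 else 0) := by
  have e : (⟨fun x => ((1 + ε * twoCos x : ℝ) : ℂ),
      Complex.continuous_ofReal.comp (continuous_const.add
        (continuous_const.mul continuous_twoCos))⟩ : C(𝕋, ℂ)) =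
      fourier 0 + (ε : ℂ) • (fourier 1 + fourier (-1)) := by
    ext x
    have h : ((twoCos x : ℝ) : ℂ) = fourier 1 x + fourier (-1) x := by
      rw [fourier_neg, Complex.add_conj, twoCos]
    simp only [ContinuousMap.coe_mk, ContinuousMap.add_apply, ContinuousMap.smul_apply,
      fourier_zero, smul_eq_mul, ← h]
    push_cast
    ring
  rw [e, ← fourierCoeffCLM_apply, map_add, map_smul, map_add]
  simp only [fourierCoeffCLM_apply, fourierCoeff_fourier_apply, smul_eq_mul]

theorem IsPoissonOperator.mul_exp_le {p q t : ℝ} [Fact (1 ≤ ENNReal.ofReal p)]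
    [Fact (1 ≤ ENNReal.ofReal q)] (hp : 0 < p) (hq : 0 < q)
    {T : Lp ℂ (ENNReal.ofReal p) 𝕞 →L[ℂ] Lp ℂ (ENNReal.ofReal q) 𝕞}
    (hT : IsPoissonOperator t T) (hn : ‖T‖ ≤ 1) :
    (q - 1) * Real.exp (-t) ^ 2 ≤ p - 1 := by
  have hρ := Real.exp_pos (-t)
  refine mul_sq_le_of_integral_twoCos_rpow_le hp hq hρ ?_
  -- Since `twoCos` is bounded by 2, amplitudes at most 1/2 keep both the test function and its
  -- image nonnegative, so absolute values drop out of the norms.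
  have hsmall : ∀ᶠ ε : ℝ in nhdsWithin 0 (Set.Ioi 0), ε < min (1 / 2) (1 / 2 / Real.exp (-t)) :=
    nhdsWithin_le_nhds (Iio_mem_nhds (by positivity))
  filter_upwards [hsmall, self_mem_nhdsWithin] with ε h1 (h0 : 0 < ε)
  have hε1 : ε ≤ 1 / 2 := h1.le.trans (min_le_left _ _)
  have hε2 : ε * Real.exp (-t) ≤ 1 / 2 := (le_div_iff₀ hρ).1 (h1.le.trans (min_le_right _ _))
  have hnorm : ∀ η : ℝ, 0 < η → η ≤ 1 / 2 → ∀ x,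
      ‖((1 + η * twoCos x : ℝ) : ℂ)‖ = 1 + η * twoCos x := fun η hη hη2 x => by
    have := (abs_le.1 (abs_twoCos_le x)).1
    rw [Complex.norm_real, Real.norm_of_nonneg]
    nlinarith
  let φ : ℝ → C(𝕋, ℂ) := fun η => ⟨fun x => ((1 + η * twoCos x : ℝ) : ℂ),
      Complex.continuous_ofReal.comp (continuous_const.add
        (continuous_const.mul continuous_twoCos))⟩
  have hTφ := hT.toLp_eq (φ ε) (φ (ε * Real.exp (-t))) fun k => by
    simp only [φ]
    rw [fourierCoeff_one_add_twoCos, fourierCoeff_one_add_twoCos]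
    by_cases k0 : k = 0
    · subst k0; simp
    by_cases k1 : k = 1
    · subst k1; simp; ring
    by_cases k2 : k = -1
    · subst k2; simp; ring
    · simp [Ne.symm k0, Ne.symm k1, Ne.symm k2]
  have hle := T.le_of_opNorm_le hn (ContinuousMap.toLp (ENNReal.ofReal p) 𝕞 ℂ (φ ε))
  rw [hTφ, one_mul, norm_toLp_ofReal hq, norm_toLp_ofReal hp] at hle
  simp only [φ, ContinuousMap.coe_mk] at hle
  simp_rw [hnorm ε h0 hε1, hnorm _ (mul_pos h0 hρ) hε2] at hle
  exact hle

/-! ### The equivalence -/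

theorem mainTheorem6 (p q t : ℝ) (hp : 1 < p) (hpq : p ≤ q) (ht : 0 ≤ t)
    [Fact (1 ≤ ENNReal.ofReal p)] [Fact (1 ≤ ENNReal.ofReal q)] :
    (∃ T : Lp ℂ (ENNReal.ofReal p) (haarAddCircle (T := 1)) →L[ℂ]
        Lp ℂ (ENNReal.ofReal q) (haarAddCircle (T := 1)),
      IsPoissonOperator t T ∧ ‖T‖ = 1) ↔
    t ≥ 1 / 2 * Real.log ((q - 1) / (p - 1)) := by
  have hp1 : 0 < p - 1 := by linarith
  have hq1 : 0 < q - 1 := by linarith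
  have hiff : t ≥ 1 / 2 * Real.log ((q - 1) / (p - 1)) ↔ q ≤ 1 + (p - 1) * Real.exp (2 * t) := by
    have : t ≥ 1 / 2 * Real.log ((q - 1) / (p - 1)) ↔ Real.log ((q - 1) / (p - 1)) ≤ 2 * t := by
      constructor <;> intro h <;> linarith
    rw [this, Real.log_le_iff_le_exp (by positivity), div_le_iff₀ hp1]
    constructor <;> intro h <;> linarith
  rw [hiff]
  constructor
  · rintro ⟨T, hT, hn⟩
    have h := hT.mul_exp_le (by linarith) (by linarith) hn.le
    have he : Real.exp (-t) ^ 2 * Real.exp (2 * t) = 1 := by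
      rw [← Real.exp_nat_mul, ← Real.exp_add, ← Real.exp_zero]
      congr 1
      push_cast
      ring
    have := mul_le_mul_of_nonneg_right h (Real.exp_pos (2 * t)).le
    rw [mul_assoc, he] at this
    linarith
  · intro h
    -- At t = 0 the radius is 1 and there is no kernel, but then the condition forces q = p and the
    -- identity is the operator.
    rcases ht.eq_or_lt with rfl | ht
    · have : q = p := by
        rw [mul_zero, Real.exp_zero] at h
        linarith
      subst this
      have hT : IsPoissonOperator 0
          (ContinuousLinearMap.id ℂ (Lp ℂ (ENNReal.ofReal q) (haarAddCircle (T := 1)))) :=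
        fun f k => by simp
      exact ⟨_, hT, le_antisymm ContinuousLinearMap.norm_id_le (one_le_norm_of_isPoissonOperator hT)⟩
    · have h1 : Real.exp (-t) < 1 := by
        rw [← Real.exp_zero]; exact Real.exp_lt_exp.2 (by linarith)
      exact ⟨_, isPoissonOperator_comp_poissonCLM h1,
        le_antisymm (norm_comp_poissonCLM_le_one hp ht h h1)
          (one_le_norm_of_isPoissonOperator (isPoissonOperator_comp_poissonCLM h1))⟩
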